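/- Let $X$ be a Banach space and consider $$\partial_t u=Au+f(u),\qquad u|_{\partial\Omega}=b,\qquad u(0)=u_0 ,$$ where $A$ is a linear (differential) operator in $X$ with domain $D(A)$, $x\mapsto x|_{\partial\Omega}$ is a linear boundary operator on $D(A)$, $b$ is time-independent boundary data and $f:X\to X$. Let $A_0$ be the restriction of $A$ to $\{x\in D(A): x|_{\partial\Omega}=0\}$ and assume that $A_0$ generates a $C_0$ semigroup $e^{tA_0}$. Let $u\in C^3([0,T];X)$, $T>0$, be a classical solution on $[0,T]$, and let $f$ be of class $C^2$ in a neighbourhood of $\{u(t):0\le t\le T\}$. Let $\varphi^f_t$ be the flow of $\partial_t w=f(w)$, let $\varphi^A_t$ be the (mild) solution operator of $\partial_t v=Av$, $v|_{\partial\Omega}=b$, and let $$S_\tau=\varphi^f_{\tau/2}\circ\varphi^A_\tau\circ\varphi^f_{\tau/2}$$ be the unmodified Strang splitting, with $u_{n+1}=S_\tau(u_n)$ and $t_n=n\tau$. We say that the local (respectively global) error is $O(r(\tau))$ if there are $C$ and $\tau_0>0$ such that, for all $0<\tau\le\tau_0$, $S_\tau(u(t))$ is defined and $\|S_\tau(u(t))-u(t+\tau)\|\le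 C\,r(\tau)$ for all $t\ge 0$ with $t+\tau\le T$ (respectively, $u_1,\dots,u_n$ are defined and $\|u_n-u(t_n)\|\le C\,r(\tau)$ for all $n$ with $t_n\le T$). The parabolic smoothing property is $\|e^{tA_0}A_0x\|\le (C/t)\|x\|$ for $0<t\le T$, $x\in D(A_0)$, with $C$ independent of $t$ and $x$. Then the following hold. 1. Without any condition on $f$ at the boundary (in particular if $f(b)\neq 0$), the method is of order one: the local error is $O(\tau)$ and, under the parabolic smoothing property, the global error is $O(\tau(1+|\log\tau|))$. 2. Suppose that $f(b)=0$, i.e. the reaction leaves the boundary data invariant: for every $x\in D(A)$ with $x|_{\partial\Omega}=b$ and $f(x)\in D(A)$ we have $f(x)|_{\partial\Omega}=0$. Suppose also that $f(u(t))\in D(A)$ with $t\mapsto Af(u(t))$ continuous on $[0,T]$. Then the local error is $O(\tau^2)$ and, under the parabolic smoothing property, the global error is $O(\tau^2(1+|\log\tau|))$. 3. Suppose that $f(b)=0$ as in 2, that for some $\sigma>0$ the elements $f(u(t)+sf(u(t)))$ lie in $D(A)$ and $(t,s)\mapsto Af(u(t)+sf(u(t)))$ is $C^1$ on $[0,T]\times[0,\sigma]$,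 and that $Af(u(t))\in D(A)$ with $t\mapsto A^2f(u(t))$ continuous. If in addition $Af(u(t))|_{\partial\Omega}=0$ for $0\le t\le T$ (which holds in particular if $Af(x)|_{\partial\Omega}=0$ for all sufficiently smooth $x$ with $x|_{\partial\Omega}=b$), then the local error is $O(\tau^3)$ and the global error is $O(\tau^2)$, even without the parabolic smoothing property. -/

import Mathlib

open Set Filter Topology

namespace StrangBoundary

section

variable {X Y : Type*} [NormedAddCommGroup X] [NormedSpace ℝ X] [AddCommGroup Y] [Module ℝ Y]

/-! The evolution problem `∂ₜ u = A u + f u`, `u|∂Ω = b`, `u 0 = u₀` in a Banach space `X`.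
`A` is the differential operator without boundary conditions, defined on the subspace
`A.domain` of `X`; `B` is the linear boundary operator `x ↦ x|∂Ω` on `A.domain`, with values in a
vector space `Y` of boundary data; `f : X → X` is the reaction. Complex Banach spaces are covered
by restriction of scalars. -/

/-- `x` lies in the domain of `A` and `x|∂Ω = y`. -/
def HasBoundaryValue (A : X →ₗ.[ℝ] X) (B : A.domain →ₗ[ℝ] Y) (x : X) (y : Y) : Prop :=
  ∃ h : x ∈ A.domain, B ⟨x, h⟩ = y

/-- `A₀`: the operator `A` endowed with homogeneous boundary conditions, that is, `A` restricted
to those `x` in its domain for which `x|∂Ω = 0`. -/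
noncomputable def dirichletRealization (A : X →ₗ.[ℝ] X) (B : A.domain →ₗ[ℝ] Y) : X →ₗ.[ℝ] X :=
  A.domRestrict ((LinearMap.ker B).map A.domain.subtype)

/-- Strongly continuous semigroups (only the values of `S` at `t ≥ 0` matter). -/
structure IsC0Semigroup (S : ℝ → X →L[ℝ] X) : Prop where
  zero : ∀ x, S 0 x = x
  add : ∀ s t, 0 ≤ s → 0 ≤ t → ∀ x, S (s + t) x = S s (S t x)
  tendsto : ∀ x, Tendsto (fun t => S t x) (𝓝[>] 0) (𝓝 x)

/-- `A₀` is the infinitesimal generator of `S`: `x` is in the domain of `A₀` and `A₀ x = y` if and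
only if `(S t x - x) / t → y` as `t ↓ 0`. -/
def IsGenerator (A₀ : X →ₗ.[ℝ] X) (S : ℝ → X →L[ℝ] X) : Prop :=
  ∀ x y, (x, y) ∈ A₀.graph ↔ Tendsto (fun t : ℝ => t⁻¹ • (S t x - x)) (𝓝[>] 0) (𝓝 y)

/-- The parabolic smoothing property `‖exp (t A₀) A₀‖ ≤ C / t` for `0 < t ≤ T`. -/
def ParabolicSmoothing (A₀ : X →ₗ.[ℝ] X) (S : ℝ → X →L[ℝ] X) (T : ℝ) : Prop :=
  ∃ C : ℝ, ∀ t ∈ Ioc 0 T, ∀ x : A₀.domain, ‖S t (A₀ x)‖ ≤ C / t * ‖(x : X)‖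

/-- `u` is a classical solution of `∂ₜ u = A u + f u`, `u|∂Ω = b` on `[0, T]`. -/
def IsExactSolution (A : X →ₗ.[ℝ] X) (B : A.domain →ₗ[ℝ] Y) (b : Y) (f : X → X) (T : ℝ)
    (u : ℝ → X) : Prop :=
  ∀ t ∈ Icc 0 T, ∃ h : u t ∈ A.domain,
    B ⟨u t, h⟩ = b ∧ HasDerivWithinAt u (A ⟨u t, h⟩ + f (u t)) (Icc 0 T) t

/-- `w` solves the partial flow `∂ₜ w = f w`, `w 0 = w₀` on `[0, τ]`. -/
def IsReactionFlow (f : X → X) (τ : ℝ) (w₀ : X) (w : ℝ → X) : Prop :=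
  w 0 = w₀ ∧ ∀ t ∈ Icc 0 τ, HasDerivWithinAt w (f (w t)) (Icc 0 τ) t

/-- `v` is the mild solution on `[0, τ]` of the partial flow `∂ₜ v = A v`, `v|∂Ω = b`, `v 0 = v₀`,
for an arbitrary initial value `v₀` in `X`, which need not satisfy the boundary condition: `v` is
continuous and satisfies both equations after integration in time. -/
def IsLinearFlow (A : X →ₗ.[ℝ] X) (B : A.domain →ₗ[ℝ] Y) (b : Y) (τ : ℝ) (v₀ : X)
    (v : ℝ → X) : Prop :=
  ContinuousOn v (Icc 0 τ) ∧
    ∀ t ∈ Icc 0 τ, ∃ h : (∫ s in (0 : ℝ)..t, v s) ∈ A.domain,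
      B ⟨∫ s in (0 : ℝ)..t, v s, h⟩ = t • b ∧ v t = v₀ + A ⟨∫ s in (0 : ℝ)..t, v s, h⟩

/-- `y = S_τ x` for the unmodified Strang splitting with step size `τ`: half a step of the reaction
flow, a full step of the linear flow with boundary data `b`, half a step of the reaction flow. -/
def IsStrangStep (A : X →ₗ.[ℝ] X) (B : A.domain →ₗ[ℝ] Y) (b : Y) (f : X → X) (τ : ℝ)
    (x y : X) : Prop :=
  ∃ w v z : ℝ → X, IsReactionFlow f (τ / 2) x w ∧ IsLinearFlow A B b τ (w (τ / 2)) v ∧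
    IsReactionFlow f (τ / 2) (v τ) z ∧ y = z (τ / 2)

/-- `U 0, …, U n` are the Strang approximations with step size `τ` and initial value `u₀`. -/
def IsStrangSequence (A : X →ₗ.[ℝ] X) (B : A.domain →ₗ[ℝ] Y) (b : Y) (f : X → X) (τ : ℝ)
    (u₀ : X) (n : ℕ) (U : ℕ → X) : Prop :=
  U 0 = u₀ ∧ ∀ k < n, IsStrangStep A B b f τ (U k) (U (k + 1))

/-- For all small `τ` the Strang step from `u t` is defined, and the local error
`S_τ (u t) - u (t + τ)` is bounded by `C * r τ`, uniformly in `t`. -/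
def LocalError (A : X →ₗ.[ℝ] X) (B : A.domain →ₗ[ℝ] Y) (b : Y) (f : X → X) (T : ℝ)
    (u : ℝ → X) (r : ℝ → ℝ) : Prop :=
  ∃ C τ₀ : ℝ, 0 < τ₀ ∧ ∀ τ ∈ Ioc 0 τ₀, ∀ t, 0 ≤ t → t + τ ≤ T →
    (∃ y, IsStrangStep A B b f τ (u t) y) ∧
      ∀ y, IsStrangStep A B b f τ (u t) y → ‖y - u (t + τ)‖ ≤ C * r τ

/-- For all small `τ` the Strang approximations starting at `u 0` are defined as long as
`n τ ≤ T`, and the global error `U n - u (n τ)` is bounded by `C * r τ`, uniformly in `n`. -/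
def GlobalError (A : X →ₗ.[ℝ] X) (B : A.domain →ₗ[ℝ] Y) (b : Y) (f : X → X) (T : ℝ)
    (u : ℝ → X) (r : ℝ → ℝ) : Prop :=
  ∃ C τ₀ : ℝ, 0 < τ₀ ∧ ∀ τ ∈ Ioc 0 τ₀, ∀ n : ℕ, n * τ ≤ T →
    (∃ U, IsStrangSequence A B b f τ (u 0) n U) ∧
      ∀ U, IsStrangSequence A B b f τ (u 0) n U → ‖U n - u (n * τ)‖ ≤ C * r τ

/-- `f(b) = 0`, that is, the reaction leaves the boundary data `b` invariant: `f x` vanishes on the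
boundary whenever `x|∂Ω = b` (as far as `f x` has a boundary value). -/
def ReactionVanishesOnBoundary (A : X →ₗ.[ℝ] X) (B : A.domain →ₗ[ℝ] Y) (b : Y)
    (f : X → X) : Prop :=
  ∀ x, HasBoundaryValue A B x b → ∀ h : f x ∈ A.domain, B ⟨f x, h⟩ = 0

/-- Spatial smoothness of `f (u t)`: `A f (u t)` is defined and continuous in `t`. No boundary
condition is imposed on `f (u t)`. -/
def SmoothReaction (A : X →ₗ.[ℝ] X) (f : X → X) (T : ℝ) (u : ℝ → X) : Prop :=
  ∃ g : ℝ → X, ContinuousOn g (Icc 0 T) ∧ ∀ t ∈ Icc 0 T, (f (u t), g t) ∈ A.graph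

/-- Higher spatial smoothness: `A f (u t + s • f (u t))` is defined and continuously differentiable
in `(t, s)` for small `s ≥ 0`, and `A² f (u t)` is defined and continuous in `t`. No boundary
condition is imposed on any of these elements. -/
def VerySmoothReaction (A : X →ₗ.[ℝ] X) (f : X → X) (T : ℝ) (u : ℝ → X) : Prop :=
  ∃ (σ : ℝ) (G : ℝ × ℝ → X) (g : ℝ → X), 0 < σ ∧
    ContDiffOn ℝ 1 G (Icc 0 T ×ˢ Icc 0 σ) ∧
    (∀ t ∈ Icc 0 T, ∀ s ∈ Icc 0 σ, (f (u t + s • f (u t)), G (t, s)) ∈ A.graph) ∧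
    ContinuousOn g (Icc 0 T) ∧ ∀ t ∈ Icc 0 T, (G (t, 0), g t) ∈ A.graph

end

end StrangBoundary

/-! Write `S` for the semigroup of the operator `A₀` with homogeneous boundary values. Subtracting
an element with the right boundary data turns both the exact solution and the linear flow into
variation-of-constants formulas in `S`. Expanded around `u t`, the contributions of `A (u t)` cancel
(`IsLinearFlow.sub_eq`), so the defect of one step involves the reaction only. With y = f(u), D =
f'(u) and u' the time derivative, all at time t, it equals [(τ/2)(S(τ)y + y) - ∫₀^τ S(s)y ds] +
(τ²/8)(S(τ) - 1)Dy - ∫₀^τ s(S(τ-s) - 1)Du' ds + O(τ³), the bracket being the trapezoidal rule error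
for s ↦ S(s)y. Stopping after the bracket leaves O(τ²) in general; the O(τ³) form needs (S(r) - 1)y
= O(τ) for r ≤ τ.

The order is thus decided by how regular y, Dy and Du' are for `A₀`, which is where the boundary
enters. For arbitrary y the bracket is only O(τ). If y is in D(A₀), the bracket is O(τ²). If A₀y is
also in D(A₀), with bounded A₀²y, the bracket is O(τ³). In that last case Dy and Du' are limits of
difference quotients of elements of D(A₀) whose images stay bounded, so their orbits are Lipschitz
and the other two terms are O(τ³) as well.

For the global error, two Strang steps differ by S(τ) applied to the difference of their arguments,
up to O(τ) times that difference (`IsStrangStep.norm_sub_sub_le`). A discrete variation of constants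
and Gronwall's inequality reduce the error to the sum of the terms S((n-1-k)τ)d_k over the defects
d_k. A local error O(τ³) loses one power of τ by summation. In the other cases every leading term
contains a factor S(r) - 1 with r ≤ τ, and (S(r) - 1)x = A₀∫₀^r S(s)x ds; parabolic smoothing hence
bounds S(s)d_k with an additional factor τ/s on these terms. Summing 1/(n-1-k) costs only a
logarithm, and the most recent defect, which is not smoothed, is bounded by the local error. -/

namespace StrangBoundary

/-! ### Strongly continuous semigroups, their generators and variation of constants -/

section Semigroup

variable {X : Type*} [NormedAddCommGroup X] [NormedSpace ℝ X]

theorem IsC0Semigroup.tendsto_nhdsGE {S : ℝ → X →L[ℝ] X} (hS : IsC0Semigroup S) (x : X) :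
    Tendsto (fun t => S t x) (𝓝[≥] 0) (𝓝 x) := by
  have h : ContinuousWithinAt (fun t => S t x) (Ioi 0) 0 := by
    have := hS.tendsto x
    rwa [ContinuousWithinAt, hS.zero x]
  have h2 := continuousWithinAt_Ioi_iff_Ici.1 h
  rwa [ContinuousWithinAt, hS.zero x] at h2

theorem IsC0Semigroup.exists_norm_le_near_zero [CompleteSpace X] {S : ℝ → X →L[ℝ] X}
    (hS : IsC0Semigroup S) : ∃ δ > 0, ∃ M : ℝ, ∀ t ∈ Icc 0 δ, ‖S t‖ ≤ M := by
  by_contra! H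
  -- Norms larger than n at times t n → 0 contradict the uniform boundedness principle, since every
  -- orbit converges along t n.
  choose t ht hlt using fun n : ℕ => H (1 / ((n : ℝ) + 1)) (by positivity) n
  have ht0 : Tendsto t atTop (𝓝[≥] 0) := by
    refine tendsto_nhdsWithin_iff.2 ⟨?_, Eventually.of_forall fun n => (ht n).1⟩
    exact squeeze_zero (fun n => (ht n).1) (fun n => (ht n).2)
      tendsto_one_div_add_atTop_nhds_zero_nat
  obtain ⟨C, hC⟩ := banach_steinhaus (g := fun n => S (t n)) fun x => by
    obtain ⟨C, hC⟩ := ((hS.tendsto_nhdsGE x).comp ht0).norm.bddAbove_range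
    exact ⟨C, fun n => hC ⟨n, rfl⟩⟩
  obtain ⟨n, hn⟩ := exists_nat_gt C
  linarith [hC n, hlt n]

theorem IsC0Semigroup.exists_norm_le [CompleteSpace X] {S : ℝ → X →L[ℝ] X}
    (hS : IsC0Semigroup S) (T : ℝ) : ∃ M ≥ 1, ∀ t ∈ Icc 0 T, ‖S t‖ ≤ M := by
  obtain ⟨δ, hδ, M, hM⟩ := hS.exists_norm_le_near_zero
  set K := max M 1
  have hK : 1 ≤ K := le_max_right _ _
  have key : ∀ n : ℕ, ∀ t ∈ Icc 0 (n * δ), ‖S t‖ ≤ K ^ n := by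
    intro n
    induction n with
    | zero =>
      intro t ht
      have h0 : t = 0 := le_antisymm (by simpa using ht.2) ht.1
      subst h0
      refine ContinuousLinearMap.opNorm_le_bound _ (by simp) fun x => ?_
      simp [hS.zero x]
    | succ n ih =>
      intro t ht
      by_cases h : t ≤ δ
      · calc ‖S t‖ ≤ K := (hM t ⟨ht.1, h⟩).trans (le_max_left _ _)
          _ ≤ K ^ (n + 1) := le_self_pow₀ hK (by simp)
      · push Not at h
        have h1 : ‖S δ‖ ≤ K := (hM δ ⟨hδ.le, le_rfl⟩).trans (le_max_left _ _)
        have h2 : ‖S (t - δ)‖ ≤ K ^ n := by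
          refine ih _ ⟨by linarith, ?_⟩
          have := ht.2
          push_cast at this
          linarith
        refine ContinuousLinearMap.opNorm_le_bound _ (by positivity) fun x => ?_
        have h3 := hS.add δ (t - δ) hδ.le (by linarith) x
        rw [add_sub_cancel] at h3
        rw [h3, pow_succ', mul_assoc]
        calc ‖S δ (S (t - δ) x)‖ ≤ ‖S δ‖ * ‖S (t - δ) x‖ := (S δ).le_opNorm _
          _ ≤ K * (K ^ n * ‖x‖) := by
            gcongr
            exact (S (t - δ)).le_of_opNorm_le h2 x
  obtain ⟨n, hn⟩ := exists_nat_ge (T / δ)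
  refine ⟨K ^ n, one_le_pow₀ hK, fun t ht => key n t ⟨ht.1, ht.2.trans ?_⟩⟩
  rwa [div_le_iff₀ hδ] at hn

/-- Factoring out the earlier of the two times reduces continuity from both sides to right
continuity at 0. -/
theorem IsC0Semigroup.norm_sub_le {S : ℝ → X →L[ℝ] X}
    (hS : IsC0Semigroup S) {T M : ℝ} (hM : ∀ t ∈ Icc 0 T, ‖S t‖ ≤ M) {a b : ℝ} (ha : a ∈ Icc 0 T)
    (hb : b ∈ Icc 0 T) (x : X) : ‖S b x - S a x‖ ≤ M * ‖S |b - a| x - x‖ := by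
  wlog hab : a ≤ b generalizing a b
  · rw [norm_sub_rev, abs_sub_comm]
    exact this hb ha (by linarith)
  have h := hS.add a (b - a) ha.1 (by linarith) x
  rw [add_sub_cancel] at h
  rw [h, ← map_sub, abs_of_nonneg (by linarith)]
  exact (S a).le_of_opNorm_le (hM a ha) _

theorem IsC0Semigroup.continuous_max [CompleteSpace X] {S : ℝ → X →L[ℝ] X}
    (hS : IsC0Semigroup S) (x : X) : Continuous fun t => S (max t 0) x := by
  rw [continuous_iff_continuousAt]
  intro t
  obtain ⟨M, -, hM⟩ := hS.exists_norm_le (max t 0 + 1)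
  rw [ContinuousAt, tendsto_iff_norm_sub_tendsto_zero]
  have hcont : Continuous fun s : ℝ => |max s 0 - max t 0| := by fun_prop
  have h0 : Tendsto (fun s : ℝ => |max s 0 - max t 0|) (𝓝 t) (𝓝[≥] 0) := by
    refine tendsto_nhdsWithin_iff.2 ⟨?_, Eventually.of_forall fun s => mem_Ici.2 (abs_nonneg _)⟩
    simpa using hcont.tendsto t
  have h1 : Tendsto (fun s : ℝ => M * ‖S |max s 0 - max t 0| x - x‖) (𝓝 t) (𝓝 0) := by
    have := (((hS.tendsto_nhdsGE x).comp h0).sub_const x).norm.const_mul M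
    simpa using this
  refine squeeze_zero' (Eventually.of_forall fun _ => norm_nonneg _) ?_ h1
  have h2 : ∀ᶠ s in 𝓝 t, max s 0 < max t 0 + 1 :=
    (by fun_prop : Continuous fun s : ℝ => max s 0).continuousAt.eventually_lt
      continuousAt_const (by simp)
  filter_upwards [h2] with s hs
  exact hS.norm_sub_le hM ⟨le_max_right _ _, by linarith⟩ ⟨le_max_right _ _, hs.le⟩ x

theorem IsC0Semigroup.comp_max {S : ℝ → X →L[ℝ] X} (hS : IsC0Semigroup S) :
    IsC0Semigroup fun t => S (max t 0) where
  zero x := by simp [hS.zero]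
  add s t hs ht x := by
    simp only [max_eq_left hs, max_eq_left ht, max_eq_left (add_nonneg hs ht)]
    exact hS.add s t hs ht x
  tendsto x := (hS.tendsto x).congr' <| by
    filter_upwards [self_mem_nhdsWithin] with t ht
    rw [max_eq_left (le_of_lt ht)]

theorem IsGenerator.comp_max {A₀ : X →ₗ.[ℝ] X} {S : ℝ → X →L[ℝ] X} (h : IsGenerator A₀ S) :
    IsGenerator A₀ fun t => S (max t 0) := by
  intro x y
  rw [h x y]
  refine tendsto_congr' ?_
  filter_upwards [self_mem_nhdsWithin] with t ht
  rw [max_eq_left (le_of_lt ht)]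

theorem ParabolicSmoothing.comp_max {A₀ : X →ₗ.[ℝ] X} {S : ℝ → X →L[ℝ] X} {T : ℝ}
    (h : ParabolicSmoothing A₀ S T) : ParabolicSmoothing A₀ (fun t => S (max t 0)) T := by
  obtain ⟨C, hC⟩ := h
  refine ⟨C, fun t ht x => ?_⟩
  simpa only [max_eq_left ht.1.le] using hC t ht x

/-- Semigroups extended by a constant to negative times, so that all orbits are continuous on
the whole real line. -/
structure IsContinuousSemigroup (S : ℝ → X →L[ℝ] X) : Prop extends IsC0Semigroup S where
  continuous : ∀ x, Continuous fun t => S t x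
  neg : ∀ t ≤ 0, S t = S 0

theorem IsC0Semigroup.isContinuousSemigroup_comp_max [CompleteSpace X] {S : ℝ → X →L[ℝ] X}
    (hS : IsC0Semigroup S) : IsContinuousSemigroup fun t => S (max t 0) :=
  { hS.comp_max with
    continuous := hS.continuous_max
    neg := fun t ht => by simp [max_eq_right ht] }

namespace IsContinuousSemigroup

variable {S : ℝ → X →L[ℝ] X} (hS : IsContinuousSemigroup S)
include hS

theorem continuous_uncurry [CompleteSpace X] : Continuous fun p : ℝ × X => S p.1 p.2 := by
  rw [continuous_iff_continuousAt]
  rintro ⟨t, x⟩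
  obtain ⟨M, hM1, hM⟩ := hS.exists_norm_le (max t 0 + 1)
  rw [ContinuousAt, tendsto_iff_norm_sub_tendsto_zero]
  have h1 : Tendsto (fun p : ℝ × X => M * ‖p.2 - x‖ + ‖S p.1 x - S t x‖) (𝓝 (t, x)) (𝓝 0) := by
    have hc : Continuous fun p : ℝ × X => M * ‖p.2 - x‖ + ‖S p.1 x - S t x‖ := by
      have h := (hS.continuous x).comp (continuous_fst (X := ℝ) (Y := X))
      exact ((continuous_snd.sub continuous_const).norm.const_mul M).add
        (h.sub continuous_const).norm
    simpa using hc.tendsto (t, x)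
  refine squeeze_zero' (Eventually.of_forall fun _ => norm_nonneg _) ?_ h1
  have h2 : ∀ᶠ p : ℝ × X in 𝓝 (t, x), max p.1 0 < max t 0 + 1 :=
    (by fun_prop : Continuous fun p : ℝ × X => max p.1 0).continuousAt.eventually_lt
      continuousAt_const (by simp)
  filter_upwards [h2] with p hp
  have h3 : ‖S p.1‖ ≤ M := by
    rcases le_total p.1 0 with h | h
    · rw [hS.neg _ h]
      exact hM 0 ⟨le_rfl, by positivity⟩
    · exact hM _ ⟨h, by rw [max_eq_left h] at hp; exact hp.le⟩
  calc ‖S p.1 p.2 - S t x‖ = ‖S p.1 (p.2 - x) + (S p.1 x - S t x)‖ := by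
        rw [map_sub]; congr 1; abel
    _ ≤ ‖S p.1 (p.2 - x)‖ + ‖S p.1 x - S t x‖ := norm_add_le _ _
    _ ≤ _ := by gcongr; exact (S p.1).le_of_opNorm_le h3 _

theorem intervalIntegrable (x : X) (a b : ℝ) :
    IntervalIntegrable (fun s => S s x) MeasureTheory.volume a b :=
  (hS.continuous x).intervalIntegrable _ _

omit hS in
theorem norm_integral_le {T M : ℝ} (hM : ∀ t ∈ Icc 0 T, ‖S t‖ ≤ M) {t : ℝ} (ht : t ∈ Icc 0 T)
    (x : X) : ‖∫ s in (0 : ℝ)..t, S s x‖ ≤ M * ‖x‖ * t := by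
  have := intervalIntegral.norm_integral_le_of_norm_le_const (a := 0) (b := t) (f := fun s => S s x)
    (C := M * ‖x‖) fun s hs => by
      rw [uIoc_of_le ht.1] at hs
      exact (S s).le_of_opNorm_le (hM s ⟨hs.1.le, hs.2.trans ht.2⟩) x
  simpa [abs_of_nonneg ht.1] using this

theorem hasDerivAt_integral [CompleteSpace X] (x : X) (t : ℝ) :
    HasDerivAt (fun t => ∫ s in (0 : ℝ)..t, S s x) (S t x) t :=
  intervalIntegral.integral_hasDerivAt_right (hS.intervalIntegrable x _ _)
    ((hS.continuous x).stronglyMeasurableAtFilter _ _) (hS.continuous x).continuousAt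

theorem apply_integral [CompleteSpace X] {h t : ℝ} (hh : 0 ≤ h) (ht : 0 ≤ t) (x : X) :
    S h (∫ s in (0 : ℝ)..t, S s x) = (∫ s in (0 : ℝ)..(t + h), S s x) - ∫ s in (0 : ℝ)..h, S s x := by
  rw [← ContinuousLinearMap.intervalIntegral_comp_comm _ (hS.intervalIntegrable x _ _),
    intervalIntegral.integral_interval_sub_left (hS.intervalIntegrable x _ _)
      (hS.intervalIntegrable x _ _)]
  have h1 : ∫ s in (0 : ℝ)..t, S h (S s x) = ∫ s in (0 : ℝ)..t, S (s + h) x := by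
    refine intervalIntegral.integral_congr fun s hs => ?_
    rw [uIcc_of_le ht] at hs
    rw [add_comm, hS.add h s hh hs.1]
  rw [h1, intervalIntegral.integral_comp_add_right (fun s => S s x), zero_add]

theorem tendsto_inv_smul_integral [CompleteSpace X] (x : X) :
    Tendsto (fun h : ℝ => h⁻¹ • ∫ s in (0 : ℝ)..h, S s x) (𝓝[>] 0) (𝓝 x) := by
  have := (hS.hasDerivAt_integral x 0).tendsto_slope_zero_right
  simpa [hS.zero] using this

variable {A₀ : X →ₗ.[ℝ] X} (hA : IsGenerator A₀ S)
include hA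

theorem integral_mem_graph [CompleteSpace X] {t : ℝ} (ht : 0 ≤ t) (x : X) :
    (∫ s in (0 : ℝ)..t, S s x, S t x - x) ∈ A₀.graph := by
  rw [hA]
  have h1 := (hS.hasDerivAt_integral x t).tendsto_slope_zero_right
  refine (h1.sub (hS.tendsto_inv_smul_integral x)).congr' ?_
  filter_upwards [self_mem_nhdsWithin] with h hh
  rw [hS.apply_integral (le_of_lt hh) ht, ← smul_sub]
  congr 1
  abel

/-- Instead of closedness of the generator, the difference quotient is computed directly: with J r
the integral of the orbit over [0, r], S h (J r) - J r is symmetric in h and r. The quotient becomes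
an integral of S r applied to h⁻¹ J h, which tends to x, and the operators are uniformly bounded. -/
theorem integral_integral_mem_graph [CompleteSpace X] {t : ℝ} (ht : 0 ≤ t) (x : X) :
    (∫ r in (0 : ℝ)..t, ∫ s in (0 : ℝ)..r, S s x, (∫ s in (0 : ℝ)..t, S s x) - t • x)
      ∈ A₀.graph := by
  rw [hA]
  have hJ : Continuous fun r : ℝ => ∫ s in (0 : ℝ)..r, S s x :=
    continuous_iff_continuousAt.2 fun r => (hS.hasDerivAt_integral x r).continuousAt
  obtain ⟨M, -, hM⟩ := hS.exists_norm_le t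
  have hlim : Tendsto (fun h : ℝ => (∫ s in (0 : ℝ)..t, S s (h⁻¹ • ∫ s in (0 : ℝ)..h, S s x))
      - t • (h⁻¹ • ∫ s in (0 : ℝ)..h, S s x)) (𝓝[>] 0)
      (𝓝 ((∫ s in (0 : ℝ)..t, S s x) - t • x)) := by
    have h0 := hS.tendsto_inv_smul_integral x
    refine Tendsto.sub ?_ (h0.const_smul t)
    rw [tendsto_iff_norm_sub_tendsto_zero] at h0 ⊢
    have h1 : Tendsto (fun h : ℝ => M * ‖(h⁻¹ • ∫ s in (0 : ℝ)..h, S s x) - x‖ * t) (𝓝[>] 0)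
        (𝓝 0) := by simpa using (h0.const_mul M).mul_const t
    refine squeeze_zero (fun _ => norm_nonneg _) (fun h => ?_) h1
    rw [← intervalIntegral.integral_sub (hS.intervalIntegrable _ _ _)
      (hS.intervalIntegrable _ _ _)]
    simp only [← map_sub]
    exact norm_integral_le hM ⟨ht, le_rfl⟩ _
  refine hlim.congr' ?_
  filter_upwards [self_mem_nhdsWithin] with h hh
  have hh : 0 ≤ h := le_of_lt hh
  have hSJ : Continuous fun r : ℝ => S h (∫ s in (0 : ℝ)..r, S s x) := (S h).continuous.comp hJ
  rw [← ContinuousLinearMap.intervalIntegral_comp_comm _ (hJ.intervalIntegrable _ _),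
    ← intervalIntegral.integral_sub (hSJ.intervalIntegrable _ _) (hJ.intervalIntegrable _ _)]
  -- Both sides equal J (r + h) - J h - J r.
  have e : ∀ r ∈ uIcc 0 t, S h (∫ s in (0 : ℝ)..r, S s x) - ∫ s in (0 : ℝ)..r, S s x
      = S r (∫ s in (0 : ℝ)..h, S s x) - ∫ s in (0 : ℝ)..h, S s x := by
    intro r hr
    rw [uIcc_of_le ht] at hr
    rw [hS.apply_integral hh hr.1, hS.apply_integral hr.1 hh, add_comm]
    abel
  rw [intervalIntegral.integral_congr e, intervalIntegral.integral_sub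
    (hS.intervalIntegrable _ _ _) (by simp)]
  simp only [map_smul, intervalIntegral.integral_smul, intervalIntegral.integral_const, sub_zero,
    smul_sub]
  rw [smul_comm]

/-- The variation of constants formula. -/
theorem eq_add_integral_of_hasDerivWithinAt [CompleteSpace X] {τ : ℝ} (hτ : 0 ≤ τ)
    {η η' a : ℝ → X} (hη : ContinuousOn η (Icc 0 τ))
    (hderiv : ∀ s ∈ Ioo 0 τ, HasDerivWithinAt η (η' s) (Ioi s) s)
    (ha : ∀ s ∈ Ioo 0 τ, (η s, a s) ∈ A₀.graph) {g : ℝ → X}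
    (hg : ContinuousOn g (Icc 0 τ)) (hgη : ∀ s ∈ Ioo 0 τ, η' s = a s + g s) :
    η τ = S τ (η 0) + ∫ s in (0 : ℝ)..τ, S (τ - s) (g s) := by
  have hcu := hS.continuous_uncurry
  have hcont : ∀ {k : ℝ → X}, ContinuousOn k (Icc 0 τ) →
      ContinuousOn (fun s => S (τ - s) (k s)) (Icc 0 τ) := fun {k} hk =>
    hcu.comp_continuousOn (f := fun s => (τ - s, k s)) (by fun_prop)
  have key := intervalIntegral.integral_eq_sub_of_hasDeriv_right_of_le hτ (hcont hη)
    (f' := fun s => S (τ - s) (g s)) (fun s hs => ?_)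
    ((hcont hg).intervalIntegrable_of_Icc hτ)
  · rw [key]
    simp [hS.zero]
  -- The right derivative of s ↦ S (τ - s) (η s): with S (τ - r) factored out, the difference
  -- quotient is the slope of η minus the generator quotient at the fixed vector η s. Its limit is
  -- η' s - a s = g s, and joint continuity of the semigroup handles the outer factor.
  · have hA' := (hA _ _).1 (ha s hs)
    have hd := hasDerivWithinAt_iff_tendsto_slope' (by simp) |>.1 (hderiv s hs)
    rw [hasDerivWithinAt_iff_tendsto_slope' (by simp)]
    have hsub : Tendsto (fun r : ℝ => r - s) (𝓝[>] s) (𝓝[>] 0) := by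
      refine tendsto_nhdsWithin_iff.2 ⟨?_, ?_⟩
      · have : Continuous fun r : ℝ => r - s := by fun_prop
        simpa using (this.tendsto s).mono_left nhdsWithin_le_nhds
      · filter_upwards [self_mem_nhdsWithin] with r hr
        simpa using hr
    have h1 := hd.sub (hA'.comp hsub)
    rw [hgη s hs, add_sub_cancel_left] at h1
    have h2 : Tendsto (fun r : ℝ => τ - r) (𝓝[>] s) (𝓝 (τ - s)) :=
      ((by fun_prop : Continuous fun r : ℝ => τ - r).tendsto s).mono_left nhdsWithin_le_nhds
    refine ((hcu.tendsto (τ - s, g s)).comp (h2.prodMk_nhds h1)).congr' ?_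
    filter_upwards [Ioo_mem_nhdsGT hs.2] with r hr
    have h3 := hS.add (τ - r) (r - s) (by linarith [hr.2]) (by linarith [hr.1]) (η s)
    rw [sub_add_sub_cancel] at h3
    simp only [Function.comp_apply, slope_def_module, map_sub, map_smul, h3, smul_sub]
    abel

/-- The constant function x solves η' = A₀ η - y, so this is variation of constants. -/
theorem apply_sub_eq_integral [CompleteSpace X] {x y : X} (hxy : (x, y) ∈ A₀.graph) {t : ℝ}
    (ht : 0 ≤ t) : S t x - x = ∫ s in (0 : ℝ)..t, S s y := by
  have := hS.eq_add_integral_of_hasDerivWithinAt hA ht (η := fun _ => x) (η' := fun _ => 0)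
    (a := fun _ => y) (g := fun _ => -y) (by fun_prop)
    (fun s _ => hasDerivWithinAt_const _ _ _) (fun _ _ => hxy) (by fun_prop)
    (fun _ _ => by simp)
  rw [intervalIntegral.integral_comp_sub_left (fun s => S s (-y))] at this
  simp only [sub_self, sub_zero, map_neg, intervalIntegral.integral_neg] at this
  rw [eq_sub_of_add_eq this.symm]
  abel_nf

end IsContinuousSemigroup

end Semigroup

/-! ### Inhomogeneous boundary data: the linear flow and the exact solution -/

section LinearFlow

variable {X Y : Type*} [NormedAddCommGroup X] [NormedSpace ℝ X] [AddCommGroup Y] [Module ℝ Y]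
  {A : X →ₗ.[ℝ] X} {B : A.domain →ₗ[ℝ] Y}

/-- `x` lies in the domain of `A`, `A x = y` and `x|∂Ω = b`. -/
def HasImageAndBoundaryValue (A : X →ₗ.[ℝ] X) (B : A.domain →ₗ[ℝ] Y) (x y : X) (b : Y) : Prop :=
  ∃ h : x ∈ A.domain, B ⟨x, h⟩ = b ∧ A ⟨x, h⟩ = y

theorem mem_graph_dirichletRealization_iff {x y : X} :
    (x, y) ∈ (dirichletRealization A B).graph ↔ HasImageAndBoundaryValue A B x y 0 := by
  rw [LinearPMap.mem_graph_iff]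
  constructor
  · rintro ⟨⟨z, hz1, hz2⟩, rfl, rfl⟩
    obtain ⟨⟨w, hw⟩, hw0, rfl⟩ := hz1
    exact ⟨hw, hw0, (LinearPMap.domRestrict_apply rfl).symm⟩
  · rintro ⟨h, hb, rfl⟩
    exact ⟨⟨x, ⟨⟨⟨x, h⟩, hb, rfl⟩, h⟩⟩, rfl, LinearPMap.domRestrict_apply rfl⟩

namespace HasImageAndBoundaryValue

variable {x y x' y' : X} {b b' : Y}

theorem add (h : HasImageAndBoundaryValue A B x y b) (h' : HasImageAndBoundaryValue A B x' y' b') :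
    HasImageAndBoundaryValue A B (x + x') (y + y') (b + b') := by
  obtain ⟨h, rfl, rfl⟩ := h
  obtain ⟨h', rfl, rfl⟩ := h'
  exact ⟨A.domain.add_mem h h', B.map_add ⟨x, h⟩ ⟨x', h'⟩, A.map_add ⟨x, h⟩ ⟨x', h'⟩⟩

theorem smul (h : HasImageAndBoundaryValue A B x y b) (c : ℝ) :
    HasImageAndBoundaryValue A B (c • x) (c • y) (c • b) := by
  obtain ⟨h, rfl, rfl⟩ := h
  exact ⟨A.domain.smul_mem c h, B.map_smul c ⟨x, h⟩, A.map_smul c ⟨x, h⟩⟩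

theorem sub (h : HasImageAndBoundaryValue A B x y b) (h' : HasImageAndBoundaryValue A B x' y' b') :
    HasImageAndBoundaryValue A B (x - x') (y - y') (b - b') := by
  simpa [sub_eq_add_neg] using h.add (h'.smul (-1))

end HasImageAndBoundaryValue

theorem isLinearFlow_iff {b : Y} {τ : ℝ} {v₀ : X} {v : ℝ → X} :
    IsLinearFlow A B b τ v₀ v ↔ ContinuousOn v (Icc 0 τ) ∧ ∀ t ∈ Icc 0 τ,
      HasImageAndBoundaryValue A B (∫ s in (0 : ℝ)..t, v s) (v t - v₀) (t • b) := by
  refine and_congr_right fun _ => forall₂_congr fun t _ => exists_congr fun h =>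
    and_congr_right fun _ => ?_
  rw [eq_sub_iff_add_eq', eq_comm]

variable [CompleteSpace X] {S : ℝ → X →L[ℝ] X} (hS : IsContinuousSemigroup S)
  (hA : IsGenerator (dirichletRealization A B) S) {b : Y}
include hS hA

/-- The element x lifts the boundary data. After integration in time, t • x carries the boundary
value t • b, and the two remaining integrals lie in the domain of `A₀`. -/
theorem isLinearFlow_of_hasImageAndBoundaryValue {x y : X} (hx : HasImageAndBoundaryValue A B x y b)
    (τ : ℝ) (v₀ : X) :
    IsLinearFlow A B b τ v₀ fun t => x + ((∫ s in (0 : ℝ)..t, S s y) + S t (v₀ - x)) := by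
  have hJ : ∀ y, Continuous fun r : ℝ => ∫ s in (0 : ℝ)..r, S s y := fun y =>
    continuous_iff_continuousAt.2 fun r => (hS.hasDerivAt_integral y r).continuousAt
  rw [isLinearFlow_iff]
  refine ⟨((continuous_const.add ((hJ y).add (hS.continuous _)))).continuousOn, fun t ht => ?_⟩
  have h1 := mem_graph_dirichletRealization_iff.1 (hS.integral_integral_mem_graph hA ht.1 y)
  have h2 := mem_graph_dirichletRealization_iff.1 (hS.integral_mem_graph hA ht.1 (v₀ - x))
  have h3 := (hx.smul t).add (h1.add h2)
  have hc : Continuous fun t : ℝ => (∫ s in (0 : ℝ)..t, S s y) + S t (v₀ - x) :=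
    (hJ y).add (hS.continuous _)
  rw [intervalIntegral.integral_add (by simp) (hc.intervalIntegrable _ _),
    intervalIntegral.integral_add ((hJ y).intervalIntegrable _ _) (hS.intervalIntegrable _ _ _)]
  convert h3 using 1
  · simp
  · abel
  · simp

/-- Uniqueness of mild solutions: the time integral of the difference of two of them has zero
boundary value, solves η' = A₀ η and starts at 0, hence vanishes. -/
theorem IsLinearFlow.eq {x y : X} (hx : HasImageAndBoundaryValue A B x y b)
    {τ : ℝ} (hτ : 0 ≤ τ) {v₀ : X} {v : ℝ → X} (hv : IsLinearFlow A B b τ v₀ v) :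
    v τ = x + ((∫ s in (0 : ℝ)..τ, S s y) + S τ (v₀ - x)) := by
  have hv' := isLinearFlow_of_hasImageAndBoundaryValue hS hA hx τ v₀
  set v' := fun t => x + ((∫ s in (0 : ℝ)..t, S s y) + S t (v₀ - x))
  change v τ = v' τ
  rw [isLinearFlow_iff] at hv hv'
  have hc : ContinuousOn (fun t => v t - v' t) (Icc 0 τ) := hv.1.sub hv'.1
  have hdiff : ∀ t ∈ Icc 0 τ, HasImageAndBoundaryValue A B (∫ s in (0 : ℝ)..t, (v s - v' s))
      (v t - v' t) 0 := by
    intro t ht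
    have hsub : Icc 0 t ⊆ Icc 0 τ := Icc_subset_Icc le_rfl ht.2
    rw [intervalIntegral.integral_sub ((hv.1.mono hsub).intervalIntegrable_of_Icc ht.1)
      ((hv'.1.mono hsub).intervalIntegrable_of_Icc ht.1)]
    simpa using (hv.2 t ht).sub (hv'.2 t ht)
  have key := hS.eq_add_integral_of_hasDerivWithinAt hA hτ
    (η := fun t => ∫ s in (0 : ℝ)..t, (v s - v' s)) (η' := fun t => v t - v' t)
    (a := fun t => v t - v' t) (g := fun _ => 0)
    ?_ ?_ (fun s hs => mem_graph_dirichletRealization_iff.2 (hdiff s (Ioo_subset_Icc_self hs)))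
    (by fun_prop) (by simp)
  · simp only [intervalIntegral.integral_same, map_zero, intervalIntegral.integral_zero,
      add_zero] at key
    -- The difference of the flows at time τ is A applied to this vanishing integral.
    obtain ⟨h1, -, h2⟩ := hdiff τ ⟨hτ, le_rfl⟩
    have h3 : (⟨_, h1⟩ : A.domain) = 0 := Subtype.ext key
    rw [h3, A.map_zero] at h2
    exact sub_eq_zero.1 h2.symm
  · have := intervalIntegral.continuousOn_primitive_interval (μ := MeasureTheory.volume)
      (hc.integrableOn_Icc.mono_set (uIcc_of_le hτ).subset)
    rwa [uIcc_of_le hτ] at this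
  · intro s hs
    have hcs : ContinuousAt (fun t => v t - v' t) s := hc.continuousAt (Icc_mem_nhds hs.1 hs.2)
    refine (intervalIntegral.integral_hasDerivAt_right ((hc.mono
      (Icc_subset_Icc le_rfl hs.2.le)).intervalIntegrable_of_Icc hs.1.le) ?_ hcs).hasDerivWithinAt
    exact (hc.mono Ioo_subset_Icc_self).stronglyMeasurableAtFilter isOpen_Ioo s hs

/-- The variation of constants formula for the exact solution. -/
theorem IsExactSolution.eq_add_integral {f : X → X} {T : ℝ} {u : ℝ → X}
    (hu : IsExactSolution A B b f T u) {t τ : ℝ} (ht : 0 ≤ t) (hτ : 0 ≤ τ) (htτ : t + τ ≤ T)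
    (hf : ContinuousOn (fun s => f (u s)) (Icc 0 T)) {y : X}
    (hy : HasImageAndBoundaryValue A B (u t) y b) :
    u (t + τ) = u t + ((∫ s in (0 : ℝ)..τ, S s y) + ∫ s in (0 : ℝ)..τ, S (τ - s) (f (u (t + s)))) := by
  have hu' : ∀ s ∈ Icc 0 T, ∃ z, HasImageAndBoundaryValue A B (u s) z b ∧
      HasDerivWithinAt u (z + f (u s)) (Icc 0 T) s := fun s hs => by
    obtain ⟨h, h1, h2⟩ := hu s hs
    exact ⟨_, ⟨h, h1, rfl⟩, h2⟩
  choose! a ha hd using hu'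
  have hmem : ∀ s ∈ Icc 0 τ, t + s ∈ Icc 0 T := fun s hs =>
    ⟨by linarith [hs.1], by linarith [hs.2]⟩
  have hmaps : MapsTo (fun s => t + s) (Icc 0 τ) (Icc 0 T) := hmem
  have hcf : ContinuousOn (fun s => f (u (t + s))) (Icc 0 τ) :=
    hf.comp (by fun_prop : ContinuousOn (fun s : ℝ => t + s) (Icc 0 τ)) hmaps
  have hcu : ContinuousOn u (Icc 0 T) := fun s hs => (hd s hs).continuousWithinAt
  have key := hS.eq_add_integral_of_hasDerivWithinAt hA hτ
    (η := fun s => u (t + s) - u t) (η' := fun s => a (t + s) + f (u (t + s)))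
    (a := fun s => a (t + s) - y) (g := fun s => y + f (u (t + s))) ?_ ?_ ?_
    (continuousOn_const.add hcf) (fun s _ => by abel)
  · simp only [add_zero, sub_self, map_zero, zero_add, map_add] at key
    rw [intervalIntegral.integral_add, intervalIntegral.integral_comp_sub_left (fun s => S s y),
      sub_self, sub_zero] at key
    · rw [← key]; abel
    · exact ((hS.continuous y).comp (by fun_prop : Continuous fun s : ℝ => τ - s)).intervalIntegrable
        _ _
    · exact (hS.continuous_uncurry.comp_continuousOn (f := fun s => (τ - s, f (u (t + s))))
        ((by fun_prop : Continuous fun s : ℝ => τ - s).continuousOn.prodMk hcf)).intervalIntegrable_of_Icc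
          hτ
  · exact (hcu.comp (by fun_prop : ContinuousOn (fun s : ℝ => t + s) (Icc 0 τ)) hmaps).sub
      continuousOn_const
  · intro s hs
    have h1 : HasDerivAt u (a (t + s) + f (u (t + s))) (t + s) :=
      (hd _ (hmem s (Ioo_subset_Icc_self hs))).hasDerivAt
        (Icc_mem_nhds (by linarith [hs.1]) (by linarith [hs.2]))
    exact ((h1.comp_const_add t s).sub_const _).hasDerivWithinAt
  · intro s hs
    rw [mem_graph_dirichletRealization_iff]
    simpa using (ha _ (hmem s (Ioo_subset_Icc_self hs))).sub hy

end LinearFlow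

/-! ### The reaction flow near the trajectory -/

section Reaction

variable {X : Type*} [NormedAddCommGroup X] [NormedSpace ℝ X]

/-- Bounds for `f` and its first two derivatives near `x`. -/
structure LocalBounds (f : X → X) (x : X) (ρ L : ℝ) : Prop where
  pos : 0 < ρ
  one_le : 1 ≤ L
  norm_le : ∀ a ∈ Metric.ball x ρ, ‖f a‖ ≤ L
  norm_sub_le : ∀ a ∈ Metric.ball x ρ, ∀ c ∈ Metric.ball x ρ, ‖f a - f c‖ ≤ L * ‖a - c‖
  taylor : ∀ a ∈ Metric.ball x ρ, ‖f a - f x - fderiv ℝ f x (a - x)‖ ≤ L * ‖a - x‖ ^ 2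
  norm_fderiv_le : ‖fderiv ℝ f x‖ ≤ L

theorem LocalBounds.mono {f : X → X} {x : X} {ρ L ρ' L' : ℝ} (h : LocalBounds f x ρ L)
    (hρ' : 0 < ρ') (hρ : ρ' ≤ ρ) (hL : L ≤ L') : LocalBounds f x ρ' L' where
  pos := hρ'
  one_le := h.one_le.trans hL
  norm_le a ha := (h.norm_le a (Metric.ball_subset_ball hρ ha)).trans hL
  norm_sub_le a ha c hc := (h.norm_sub_le a (Metric.ball_subset_ball hρ ha) c
    (Metric.ball_subset_ball hρ hc)).trans (by gcongr)
  taylor a ha := (h.taylor a (Metric.ball_subset_ball hρ ha)).trans (by gcongr)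
  norm_fderiv_le := h.norm_fderiv_le.trans hL

theorem exists_localBounds {f : X → X} {x₀ : X} (hf : ContDiffAt ℝ 2 f x₀) :
    ∃ r > 0, ∃ L, ∀ x ∈ Metric.ball x₀ r, LocalBounds f x r L := by
  obtain ⟨K, s, hs, hK⟩ := (hf.of_le one_le_two).exists_lipschitzOnWith
  obtain ⟨K', s', hs', hK'⟩ :=
    (hf.fderiv_right (m := 1) (by norm_num)).exists_lipschitzOnWith
  have h2 : ∀ᶠ x in 𝓝 x₀, ContDiffAt ℝ 2 f x := hf.eventually (by simp)
  have h3 : ∀ᶠ x in 𝓝 x₀, ‖f x‖ < ‖f x₀‖ + 1 :=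
    hf.continuousAt.norm.eventually_lt continuousAt_const (by simp)
  have h4 : ∀ᶠ x in 𝓝 x₀, ‖fderiv ℝ f x‖ < ‖fderiv ℝ f x₀‖ + 1 :=
    (hf.fderiv_right (m := 1) (by norm_num)).continuousAt.norm.eventually_lt continuousAt_const
      (by simp)
  obtain ⟨ε, hε, h⟩ := Metric.eventually_nhds_iff_ball.1
    (((eventually_mem_set.2 hs).and (eventually_mem_set.2 hs')).and (h2.and (h3.and h4)))
  set L : ℝ := K + K' + (‖f x₀‖ + 1) + (‖fderiv ℝ f x₀‖ + 1)
  have hK0 : (0 : ℝ) ≤ K := K.2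
  have hK0' : (0 : ℝ) ≤ K' := K'.2
  refine ⟨ε / 2, by positivity, L, fun x hx => ?_⟩
  have hsub : Metric.ball x (ε / 2) ⊆ Metric.ball x₀ ε := fun a ha => by
    rw [Metric.mem_ball] at *
    linarith [dist_triangle a x x₀]
  have hx0 : x ∈ Metric.ball x₀ ε := hsub (Metric.mem_ball_self (by positivity))
  have hn1 := norm_nonneg (f x₀)
  have hn2 := norm_nonneg (fderiv ℝ f x₀)
  refine ⟨by positivity, by linarith, fun a ha => ?_, fun a ha c hc => ?_, fun a ha => ?_, ?_⟩
  · linarith [(h a (hsub ha)).2.2.1]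
  · refine (hK.norm_sub_le (h a (hsub ha)).1.1 (h c (hsub hc)).1.1).trans ?_
    gcongr
    linarith
  · have hball : Metric.closedBall x ‖a - x‖ ⊆ Metric.ball x₀ ε := by
      refine (Metric.closedBall_subset_ball ?_).trans hsub
      rwa [← dist_eq_norm]
    have key := (convex_closedBall x ‖a - x‖).norm_image_sub_le_of_norm_fderiv_le' (𝕜 := ℝ)
      (f := f) (φ := fderiv ℝ f x) (C := K' * ‖a - x‖) (x := x) (y := a)
      (fun z hz => (h z (hball hz)).2.1.differentiableAt (by simp)) (fun z hz => ?_)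
      (Metric.mem_closedBall_self (norm_nonneg _)) (by simp [dist_eq_norm])
    · refine key.trans ?_
      rw [mul_assoc, ← sq]
      gcongr
      linarith
    · refine (hK'.norm_sub_le (h z (hball hz)).1.2 (h x hx0).1.2).trans ?_
      gcongr
      rw [← dist_eq_norm]
      exact hz
  · linarith [(h x hx0).2.2.2]

/-- The local constants hold for all centres near a given point, so finitely many of them serve the
whole compact set. -/
theorem exists_localBounds_of_isCompact {f : X → X} {K : Set X} (hK : IsCompact K)
    (hf : ∀ x ∈ K, ContDiffAt ℝ 2 f x) : ∃ ρ > 0, ∃ L, ∀ x ∈ K, LocalBounds f x ρ L := by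
  refine hK.induction_on (p := fun s => ∃ ρ > 0, ∃ L, ∀ x ∈ s, LocalBounds f x ρ L)
    ⟨1, one_pos, 0, by simp⟩ ?_ ?_ ?_
  · rintro s t hst ⟨ρ, hρ, L, h⟩
    exact ⟨ρ, hρ, L, fun x hx => h x (hst hx)⟩
  · rintro s t ⟨ρ, hρ, L, h⟩ ⟨ρ', hρ', L', h'⟩
    have := lt_min hρ hρ'
    refine ⟨min ρ ρ', this, max L L', ?_⟩
    rintro x (hx | hx)
    · exact (h x hx).mono this (min_le_left _ _) (le_max_left _ _)
    · exact (h' x hx).mono this (min_le_right _ _) (le_max_right _ _)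
  · intro x hx
    obtain ⟨r, hr, L, h⟩ := exists_localBounds (hf x hx)
    exact ⟨_, mem_nhdsWithin_of_mem_nhds (Metric.ball_mem_nhds x hr), r, hr, L, h⟩

/-- Uniform bounds for `f` near a trajectory `u`, and for `u` itself. -/
structure TrajectoryBounds (f : X → X) (u : ℝ → X) (T ρ L : ℝ) : Prop where
  pos : 0 < ρ
  one_le : 1 ≤ L
  local_bounds : ∀ t ∈ Icc 0 T, LocalBounds f (u t) ρ L
  norm_deriv_le : ∀ t ∈ Icc 0 T, ‖derivWithin u (Icc 0 T) t‖ ≤ L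
  norm_sub_le : ∀ s ∈ Icc 0 T, ∀ t ∈ Icc 0 T, ‖u t - u s‖ ≤ L * |t - s|
  taylor : ∀ s ∈ Icc 0 T, ∀ t ∈ Icc 0 T, s ≤ t →
    ‖u t - u s - (t - s) • derivWithin u (Icc 0 T) s‖ ≤ L * (t - s) ^ 2

theorem exists_trajectoryBounds {f : X → X} {u : ℝ → X} {T : ℝ} (hT : 0 < T)
    (hu : ContDiffOn ℝ 3 u (Icc 0 T)) (hf : ∀ t ∈ Icc 0 T, ContDiffAt ℝ 2 f (u t)) :
    ∃ ρ L, TrajectoryBounds f u T ρ L := by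
  obtain ⟨ρ, hρ, L, h⟩ := exists_localBounds_of_isCompact (isCompact_Icc.image_of_continuousOn
    hu.continuousOn) (by rintro _ ⟨t, ht, rfl⟩; exact hf t ht)
  have hdu : ContDiffOn ℝ 1 (derivWithin u (Icc 0 T)) (Icc 0 T) :=
    hu.derivWithin (uniqueDiffOn_Icc hT) (by norm_num)
  obtain ⟨L₁, h₁⟩ := isCompact_Icc.exists_bound_of_continuousOn hdu.continuousOn
  obtain ⟨L₂, h₂⟩ := hdu.exists_lipschitzOnWith one_ne_zero (convex_Icc 0 T) isCompact_Icc
  have hL₂ : (0 : ℝ) ≤ L₂ := L₂.2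
  have hd : ∀ t ∈ Icc 0 T, HasDerivWithinAt u (derivWithin u (Icc 0 T) t) (Icc 0 T) t :=
    fun t ht => (hu.differentiableOn (by simp) t ht).hasDerivWithinAt
  have hL1 : L ≤ max L (max L₁ L₂) := le_max_left _ _
  have hL2 : L₁ ≤ max L (max L₁ L₂) := (le_max_left _ _).trans (le_max_right _ _)
  have hL3 : (L₂ : ℝ) ≤ max L (max L₁ L₂) := (le_max_right _ _).trans (le_max_right _ _)
  refine ⟨ρ, max L (max L₁ L₂), hρ, ?_, ?_, ?_, ?_, ?_⟩
  · exact (h (u 0) ⟨0, ⟨le_rfl, hT.le⟩, rfl⟩).one_le.trans hL1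
  · exact fun t ht => (h (u t) ⟨t, ht, rfl⟩).mono hρ le_rfl hL1
  · exact fun t ht => (h₁ t ht).trans hL2
  · intro s hs t ht
    exact (convex_Icc 0 T).norm_image_sub_le_of_norm_hasDerivWithin_le hd
      (fun t ht => (h₁ t ht).trans hL2) hs ht
  · intro s hs t ht hst
    have hsub : Icc s t ⊆ Icc 0 T := Icc_subset_Icc hs.1 ht.2
    have key := (convex_Icc s t).norm_image_sub_le_of_norm_hasDerivWithin_le
      (f := fun r => u r - (r - s) • derivWithin u (Icc 0 T) s)
      (f' := fun r => derivWithin u (Icc 0 T) r - derivWithin u (Icc 0 T) s)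
      (C := L₂ * (t - s)) (x := s) (y := t) (fun r hr => ?_) (fun r hr => ?_)
      (left_mem_Icc.2 hst) (right_mem_Icc.2 hst)
    · have e : u t - (t - s) • derivWithin u (Icc 0 T) s
          - (u s - (s - s) • derivWithin u (Icc 0 T) s)
          = u t - u s - (t - s) • derivWithin u (Icc 0 T) s := by simp; abel
      rw [e, Real.norm_of_nonneg (by linarith), mul_assoc, ← sq] at key
      exact key.trans (by gcongr)
    · have h5 := ((hasDerivWithinAt_id r (Icc s t)).sub_const s).smul_const
        (derivWithin u (Icc 0 T) s)
      rw [one_smul] at h5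
      exact ((hd r (hsub hr)).mono hsub).sub h5
    · refine (h₂.norm_sub_le (hsub hr) hs).trans ?_
      gcongr
      rw [Real.norm_of_nonneg (by linarith [hr.1])]
      linarith [hr.2]

section Flow

variable {f : X → X} {x w₀ : X} {ρ L σ : ℝ} {w : ℝ → X}

/-- The mean value inequality against a comparison curve k. Constant, linear and quadratic choices
of k give the successive Taylor estimates of the flow; another solution gives stability. -/
theorem IsReactionFlow.norm_sub_le_of_norm_sub_le (hw : IsReactionFlow f σ w₀ w) (hσ : 0 ≤ σ)
    {k : ℝ → X} {k' : ℝ → X} (hk : ∀ t ∈ Icc 0 σ, HasDerivWithinAt k (k' t) (Icc 0 σ) t)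
    {C : ℝ} (hC : ∀ t ∈ Icc 0 σ, ‖f (w t) - k' t‖ ≤ C) :
    ‖w σ - w₀ - (k σ - k 0)‖ ≤ C * σ := by
  have := norm_image_sub_le_of_norm_deriv_le_segment' (fun t ht => (hw.2 t ht).sub (hk t ht))
    (fun t ht => hC t (Ico_subset_Icc_self ht)) σ ⟨hσ, le_rfl⟩
  simp only [Pi.sub_apply, hw.1, sub_zero] at this
  convert this using 2
  abel

theorem IsReactionFlow.mono (hw : IsReactionFlow f σ w₀ w) {s : ℝ} (hs : s ≤ σ) :
    IsReactionFlow f s w₀ w :=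
  ⟨hw.1, fun t ht => (hw.2 t ⟨ht.1, ht.2.trans hs⟩).mono (Icc_subset_Icc le_rfl hs)⟩

/-- A barrier argument: when the distance from w₀ first reaches the line 2Lt, the solution is still
in the ball, where its speed is at most L < 2L, so the line is not crossed. -/
theorem IsReactionFlow.mem_ball (hw : IsReactionFlow f σ w₀ w) (h : LocalBounds f x ρ L)
    (hρ : ‖w₀ - x‖ + 2 * L * σ < ρ) {s : ℝ} (hs : s ∈ Icc 0 σ) : w s ∈ Metric.ball x ρ := by
  have hL := h.one_le
  have hball : ∀ t ∈ Icc 0 σ, ‖w t - w₀‖ ≤ 2 * L * t → w t ∈ Metric.ball x ρ := by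
    intro t ht h1
    rw [Metric.mem_ball, dist_eq_norm]
    have h2 : 2 * L * t ≤ 2 * L * σ := by gcongr; exact ht.2
    linarith [norm_sub_le_norm_sub_add_norm_sub (w t) w₀ x]
  refine hball s hs ?_
  refine image_norm_le_of_norm_deriv_right_lt_deriv_boundary (f := fun t => w t - w₀) (a := 0)
    (b := σ) (f' := fun t => f (w t)) (B' := fun _ => 2 * L)
    (ContinuousOn.sub (fun t ht => (hw.2 t ht).continuousWithinAt) continuousOn_const)
    (fun t ht => ?_) (by simp [hw.1]) (fun t => ?_) (fun t ht heq => ?_) hs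
  · exact ((hw.2 t (Ico_subset_Icc_self ht)).mono_of_mem_nhdsWithin
      (Icc_mem_nhdsGE_of_mem ht)).sub_const _
  · simpa using (hasDerivAt_id t).const_mul (2 * L)
  · have := h.norm_le _ (hball t (Ico_subset_Icc_self ht) heq.le)
    linarith

theorem IsReactionFlow.norm_sub_le (hw : IsReactionFlow f σ w₀ w) (h : LocalBounds f x ρ L)
    (hρ : ‖w₀ - x‖ + 2 * L * σ < ρ) {s : ℝ} (hs : s ∈ Icc 0 σ) : ‖w s - w₀‖ ≤ L * s := by
  have := (hw.mono hs.2).norm_sub_le_of_norm_sub_le hs.1 (k := fun _ => 0) (k' := fun _ => 0)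
    (fun t _ => hasDerivWithinAt_const _ _ _) (C := L) (fun t ht => by
      simpa using h.norm_le _ (hw.mem_ball h hρ ⟨ht.1, ht.2.trans hs.2⟩))
  simpa using this

theorem IsReactionFlow.norm_sub_center_le (hw : IsReactionFlow f σ w₀ w) (h : LocalBounds f x ρ L)
    (hρ : ‖w₀ - x‖ + 2 * L * σ < ρ) {s : ℝ} (hs : s ∈ Icc 0 σ) :
    ‖w s - x‖ ≤ ‖w₀ - x‖ + L * σ := by
  have h1 : L * s ≤ L * σ := by
    have := h.one_le
    gcongr
    exact hs.2
  linarith [norm_sub_le_norm_sub_add_norm_sub (w s) w₀ x, hw.norm_sub_le h hρ hs]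

theorem IsReactionFlow.norm_sub_smul_le (hw : IsReactionFlow f σ w₀ w) (h : LocalBounds f x ρ L)
    (hρ : ‖w₀ - x‖ + 2 * L * σ < ρ) {s : ℝ} (hs : s ∈ Icc 0 σ) :
    ‖w s - w₀ - s • f x‖ ≤ L * (‖w₀ - x‖ + L * σ) * s := by
  have hd : ∀ t, HasDerivAt (fun t : ℝ => t • f x) (f x) t := fun t => by
    simpa using (hasDerivAt_id t).smul_const (f x)
  have := (hw.mono hs.2).norm_sub_le_of_norm_sub_le hs.1 (k := fun t => t • f x)
    (k' := fun _ => f x) (fun t _ => (hd t).hasDerivWithinAt) (C := L * (‖w₀ - x‖ + L * σ))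
    (fun t ht => ?_)
  · simpa using this
  · have ht' : t ∈ Icc 0 σ := ⟨ht.1, ht.2.trans hs.2⟩
    refine (h.norm_sub_le _ (hw.mem_ball h hρ ht') x (Metric.mem_ball_self h.pos)).trans ?_
    have := h.one_le
    gcongr
    exact hw.norm_sub_center_le h hρ ht'

/-- The expansion is about x rather than w₀, because the second half step starts at v τ while every
derivative of f has to be taken at u t. -/
theorem IsReactionFlow.taylor (hw : IsReactionFlow f σ w₀ w) (h : LocalBounds f x ρ L)
    (hρ : ‖w₀ - x‖ + 2 * L * σ < ρ) (hσ : 0 ≤ σ) :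
    ‖w σ - w₀ - (σ • (f x + fderiv ℝ f x (w₀ - x)) + (σ ^ 2 / 2) • fderiv ℝ f x (f x))‖
      ≤ 2 * L * (‖w₀ - x‖ + L * σ) ^ 2 * σ := by
  have hL := h.one_le
  have hd : ∀ t, HasDerivAt (fun t : ℝ => t • (f x + fderiv ℝ f x (w₀ - x))
      + (t ^ 2 / 2) • fderiv ℝ f x (f x))
      (f x + fderiv ℝ f x (w₀ - x) + t • fderiv ℝ f x (f x)) t := fun t => by
    have h1 := (hasDerivAt_id t).smul_const (f x + fderiv ℝ f x (w₀ - x))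
    have h2 := (((hasDerivAt_id t).pow 2).div_const 2).smul_const (fderiv ℝ f x (f x))
    refine (h1.add h2).congr_deriv ?_
    simp
  have := hw.norm_sub_le_of_norm_sub_le hσ (fun t _ => (hd t).hasDerivWithinAt)
    (C := 2 * L * (‖w₀ - x‖ + L * σ) ^ 2) (fun t ht => ?_)
  · simpa using this
  · have e : f (w t) - (f x + fderiv ℝ f x (w₀ - x) + t • fderiv ℝ f x (f x))
        = (f (w t) - f x - fderiv ℝ f x (w t - x)) + fderiv ℝ f x (w t - w₀ - t • f x) := by
      simp only [map_sub, map_smul]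
      abel
    have h1 := h.taylor _ (hw.mem_ball h hρ ht)
    have h2 := hw.norm_sub_center_le h hρ ht
    have h3 := hw.norm_sub_smul_le h hρ ht
    have h4 := (fderiv ℝ f x).le_of_opNorm_le h.norm_fderiv_le (w t - w₀ - t • f x)
    have h5 : L * t ≤ ‖w₀ - x‖ + L * σ := by
      have : L * t ≤ L * σ := by gcongr; exact ht.2
      linarith [norm_nonneg (w₀ - x)]
    have h0 : 0 ≤ ‖w₀ - x‖ + L * σ := by positivity
    rw [e]
    refine (norm_add_le _ _).trans ?_
    calc _ ≤ L * (‖w₀ - x‖ + L * σ) ^ 2 + L * (L * (‖w₀ - x‖ + L * σ) * t) :=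
          add_le_add (h1.trans (by gcongr)) (h4.trans (by gcongr))
      _ = L * (‖w₀ - x‖ + L * σ) ^ 2 + L * (‖w₀ - x‖ + L * σ) * (L * t) := by ring
      _ ≤ L * (‖w₀ - x‖ + L * σ) ^ 2 + L * (‖w₀ - x‖ + L * σ) * (‖w₀ - x‖ + L * σ) := by gcongr
      _ = _ := by ring

theorem IsReactionFlow.norm_sub_sub_le {w₁ : X} {w' : ℝ → X} (hw : IsReactionFlow f σ w₀ w)
    (hw' : IsReactionFlow f σ w₁ w') (h : LocalBounds f x ρ L)
    (hρ : ‖w₀ - x‖ + 2 * L * σ < ρ) (hρ' : ‖w₁ - x‖ + 2 * L * σ < ρ) (hσ : 0 ≤ σ)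
    (hLσ : L * σ ≤ 1) : ‖w σ - w' σ - (w₀ - w₁)‖ ≤ 3 * L * σ * ‖w₀ - w₁‖ := by
  have hL := h.one_le
  have hlip : LipschitzOnWith L.toNNReal f (Metric.ball x ρ) :=
    LipschitzOnWith.of_dist_le_mul fun a ha c hc => by
      rw [dist_eq_norm, dist_eq_norm, Real.coe_toNNReal _ (by linarith)]
      exact h.norm_sub_le a ha c hc
  have hr : ∀ {w₀ : X} {w : ℝ → X}, IsReactionFlow f σ w₀ w → ∀ t ∈ Ico 0 σ,
      HasDerivWithinAt w (f (w t)) (Ici t) t := fun hw t ht =>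
    (hw.2 t (Ico_subset_Icc_self ht)).mono_of_mem_nhdsWithin (Icc_mem_nhdsGE_of_mem ht)
  have key : ∀ t ∈ Icc 0 σ, ‖w t - w' t‖ ≤ 3 * ‖w₀ - w₁‖ := by
    intro t ht
    have h1 := dist_le_of_trajectories_ODE_of_mem (v := fun _ => f) (fun _ _ => hlip)
      (fun t ht => (hw.2 t ht).continuousWithinAt) (hr hw)
      (fun t ht => hw.mem_ball h hρ (Ico_subset_Icc_self ht))
      (fun t ht => (hw'.2 t ht).continuousWithinAt) (hr hw')
      (fun t ht => hw'.mem_ball h hρ' (Ico_subset_Icc_self ht)) le_rfl t ht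
    rw [dist_eq_norm, dist_eq_norm, hw.1, hw'.1, Real.coe_toNNReal _ (by linarith), sub_zero] at h1
    -- The Gronwall factor is at most e < 3, since L t ≤ L σ ≤ 1.
    have h2 : Real.exp (L * t) ≤ 3 := by
      have h3 : L * t ≤ L * σ := by gcongr; exact ht.2
      have := Real.exp_le_exp.2 (h3.trans hLσ)
      linarith [Real.exp_one_lt_d9]
    nlinarith [norm_nonneg (w₀ - w₁)]
  have := hw.norm_sub_le_of_norm_sub_le hσ hw'.2 (C := L * (3 * ‖w₀ - w₁‖)) (fun t ht =>
    (h.norm_sub_le _ (hw.mem_ball h hρ ht) _ (hw'.mem_ball h hρ' ht)).trans (by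
      gcongr; exact key t ht))
  rw [hw'.1] at this
  calc _ = ‖w σ - w₀ - (w' σ - w₁)‖ := by congr 1; abel
    _ ≤ _ := this
    _ = _ := by ring

theorem LocalBounds.exists_isReactionFlow [CompleteSpace X] (h : LocalBounds f x ρ L)
    (hρ : ‖w₀ - x‖ + 2 * L * σ < ρ) (hσ : 0 ≤ σ) : ∃ w, IsReactionFlow f σ w₀ w := by
  have hL := h.one_le
  have hsub : Metric.closedBall w₀ (L * σ) ⊆ Metric.ball x ρ := fun a ha => by
    rw [Metric.mem_ball, dist_eq_norm]
    rw [Metric.mem_closedBall, dist_eq_norm] at ha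
    have : 0 ≤ L * σ := by positivity
    linarith [norm_sub_le_norm_sub_add_norm_sub a w₀ x]
  -- With speed at most L, the radius L σ is just enough to reach time σ.
  have hpl : IsPicardLindelof (fun _ => f) (tmin := 0) (tmax := σ) ⟨0, le_rfl, hσ⟩ w₀
      (L * σ).toNNReal 0 L.toNNReal L.toNNReal := by
    refine .of_time_independent (fun a ha => ?_) ?_ ?_
    · rw [Real.coe_toNNReal _ (by positivity)] at *
      exact h.norm_le a (hsub ha)
    · rw [Real.coe_toNNReal _ (by positivity)]
      refine LipschitzOnWith.of_dist_le_mul fun a ha c hc => ?_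
      rw [dist_eq_norm, dist_eq_norm, Real.coe_toNNReal _ (by linarith)]
      exact h.norm_sub_le a (hsub ha) c (hsub hc)
    · rw [Real.coe_toNNReal _ (by positivity), Real.coe_toNNReal _ (by positivity)]
      simp [hσ]
  obtain ⟨w, hw⟩ := hpl.exists_eq_forall_mem_Icc_hasDerivWithinAt₀
  exact ⟨w, hw⟩

end Flow

end Reaction

/-! ### Quadrature errors, existence and stability of one Strang step -/

section LocalErrorExpansion

variable {X Y : Type*} [NormedAddCommGroup X] [NormedSpace ℝ X] [AddCommGroup Y] [Module ℝ Y]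
  [CompleteSpace X]

theorem norm_apply_integral_le (P : X →L[ℝ] X) {g : ℝ → X} {τ C : ℝ} (hτ : 0 ≤ τ)
    (hg : ContinuousOn g (Icc 0 τ)) (hC : ∀ s ∈ Icc 0 τ, ‖P (g s)‖ ≤ C) :
    ‖P (∫ s in (0 : ℝ)..τ, g s)‖ ≤ C * τ := by
  rw [← ContinuousLinearMap.intervalIntegral_comp_comm _ (hg.intervalIntegrable_of_Icc hτ)]
  have := intervalIntegral.norm_integral_le_of_norm_le_const (a := 0) (b := τ)
    (f := fun s => P (g s)) (C := C) fun s hs => by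
      rw [uIoc_of_le hτ] at hs
      exact hC s (Ioc_subset_Icc_self hs)
  simpa [abs_of_nonneg hτ] using this

theorem norm_integral_le_mul {g : ℝ → X} {τ C : ℝ} (hτ : 0 ≤ τ)
    (hg : ContinuousOn g (Icc 0 τ)) (hC : ∀ s ∈ Icc 0 τ, ‖g s‖ ≤ C) :
    ‖∫ s in (0 : ℝ)..τ, g s‖ ≤ C * τ := by
  simpa using norm_apply_integral_le (.id ℝ X) hτ hg hC

/-- The error of the trapezoidal rule for `s ↦ S s y`. -/
noncomputable def trapezoidalError (S : ℝ → X →L[ℝ] X) (τ : ℝ) (y : X) : X :=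
  (τ / 2) • (S τ y + y) - ∫ s in (0 : ℝ)..τ, S s y

variable {S : ℝ → X →L[ℝ] X} (hS : IsContinuousSemigroup S)
include hS

omit [CompleteSpace X] in
theorem IsContinuousSemigroup.continuous_apply_sub (y : X) : Continuous fun s => S s y - y :=
  (hS.continuous y).sub continuous_const

/-- The rule is exact for constants, so S s y may be replaced by S s y - y. The operator P will be
the identity for local errors and S s for smoothed ones. -/
theorem IsContinuousSemigroup.norm_trapezoidalError_le (P : X →L[ℝ] X) {τ c : ℝ} {y : X}
    (hτ : 0 ≤ τ) (hc : ∀ r ∈ Icc 0 τ, ‖P (S r y - y)‖ ≤ c) :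
    ‖P (trapezoidalError S τ y)‖ ≤ 2 * c * τ := by
  have hc0 : 0 ≤ c := (norm_nonneg _).trans (hc τ ⟨hτ, le_rfl⟩)
  have e : trapezoidalError S τ y = (τ / 2) • (S τ y - y) - ∫ s in (0 : ℝ)..τ, (S s y - y) := by
    rw [trapezoidalError, intervalIntegral.integral_sub (hS.intervalIntegrable _ _ _) (by simp),
      intervalIntegral.integral_const, sub_zero]
    module
  have h1 := norm_apply_integral_le P hτ (hS.continuous_apply_sub y).continuousOn hc
  rw [e, map_sub, map_smul]
  refine (norm_sub_le _ _).trans ?_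
  rw [norm_smul, Real.norm_of_nonneg (by positivity)]
  have h2 : τ / 2 * ‖P (S τ y - y)‖ ≤ τ / 2 * c := by gcongr; exact hc τ ⟨hτ, le_rfl⟩
  nlinarith [mul_nonneg hc0 hτ]

/-- The rule is exact for affine functions as well; subtracting y + s • z leaves the integral of S s
z - z, which gains one power of τ. -/
theorem IsContinuousSemigroup.norm_trapezoidalError_le_of_mem_graph {A₀ : X →ₗ.[ℝ] X}
    (hA : IsGenerator A₀ S) (P : X →L[ℝ] X) {τ c : ℝ} {y z : X}
    (hτ : 0 ≤ τ) (hyz : (y, z) ∈ A₀.graph) (hc : ∀ r ∈ Icc 0 τ, ‖P (S r z - z)‖ ≤ c) :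
    ‖P (trapezoidalError S τ y)‖ ≤ 2 * c * τ ^ 2 := by
  have hc0 : 0 ≤ c := (norm_nonneg _).trans (hc τ ⟨hτ, le_rfl⟩)
  have hr : ∀ r ∈ Icc 0 τ, ‖P (S r y - y - r • z)‖ ≤ c * τ := by
    intro r hr
    have e : S r y - y - r • z = ∫ s in (0 : ℝ)..r, (S s z - z) := by
      rw [hS.apply_sub_eq_integral hA hyz hr.1,
        intervalIntegral.integral_sub (hS.intervalIntegrable _ _ _) (by simp),
        intervalIntegral.integral_const, sub_zero]
    rw [e]
    refine (norm_apply_integral_le P hr.1 (hS.continuous_apply_sub z).continuousOn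
      fun s hs => hc s ⟨hs.1, hs.2.trans hr.2⟩).trans ?_
    gcongr
    exact hr.2
  have hcont : Continuous fun s : ℝ => s • z := by fun_prop
  have hcont' : Continuous fun s : ℝ => S s y - y - s • z := (hS.continuous_apply_sub y).sub hcont
  have e : trapezoidalError S τ y
      = (τ / 2) • (S τ y - y - τ • z) - ∫ s in (0 : ℝ)..τ, (S s y - y - s • z) := by
    rw [trapezoidalError, intervalIntegral.integral_sub
      ((hS.continuous_apply_sub y).intervalIntegrable _ _)
      (hcont.intervalIntegrable _ _),
      intervalIntegral.integral_sub (hS.intervalIntegrable _ _ _) (by simp),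
      intervalIntegral.integral_const, intervalIntegral.integral_smul_const, integral_id]
    module
  have h1 := norm_apply_integral_le P hτ hcont'.continuousOn hr
  rw [e, map_sub, map_smul]
  refine (norm_sub_le _ _).trans ?_
  rw [norm_smul, Real.norm_of_nonneg (by positivity)]
  have h2 : τ / 2 * ‖P (S τ y - y - τ • z)‖ ≤ τ / 2 * (c * τ) := by
    gcongr; exact hr τ ⟨hτ, le_rfl⟩
  nlinarith [mul_nonneg (mul_nonneg hc0 hτ) hτ]

omit [CompleteSpace X] in
theorem IsContinuousSemigroup.continuous_smul_apply_sub (τ : ℝ) (q : X) :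
    Continuous fun s : ℝ => s • (S (τ - s) q - q) :=
  continuous_id.smul (((hS.continuous q).comp (continuous_const.sub continuous_id)).sub
    continuous_const)

theorem IsContinuousSemigroup.norm_integral_smul_apply_sub_le (P : X →L[ℝ] X) {τ c : ℝ} {q : X}
    (hτ : 0 ≤ τ) (hc : ∀ r ∈ Icc 0 τ, ‖P (S r q - q)‖ ≤ c) :
    ‖P (∫ s in (0 : ℝ)..τ, s • (S (τ - s) q - q))‖ ≤ c * τ ^ 2 := by
  have hc0 : 0 ≤ c := (norm_nonneg _).trans (hc τ ⟨hτ, le_rfl⟩)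
  refine (norm_apply_integral_le P hτ (hS.continuous_smul_apply_sub τ q).continuousOn
    (C := τ * c) fun s hs => ?_).trans (by linarith [sq τ])
  rw [map_smul, norm_smul, Real.norm_of_nonneg hs.1]
  gcongr
  · exact hs.2
  · exact hc _ ⟨by linarith [hs.2], by linarith [hs.1]⟩

variable {A : X →ₗ.[ℝ] X} {B : A.domain →ₗ[ℝ] Y} {b : Y} {f : X → X}
  (hA : IsGenerator (dirichletRealization A B) S) {T : ℝ} {u : ℝ → X}
  (hu : IsExactSolution A B b f T u) {M ρ L : ℝ} (hM1 : 1 ≤ M) (hM : ∀ t ∈ Icc 0 T, ‖S t‖ ≤ M)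
  (hT : 0 < T) (hb : TrajectoryBounds f u T ρ L)

omit [CompleteSpace X] hS in
theorem IsExactSolution.hasImageAndBoundaryValue (hu : IsExactSolution A B b f T u) (hT : 0 < T)
    {t : ℝ} (ht : t ∈ Icc 0 T) :
    HasImageAndBoundaryValue A B (u t) (derivWithin u (Icc 0 T) t - f (u t)) b := by
  obtain ⟨h, h1, h2⟩ := hu t ht
  refine ⟨h, h1, ?_⟩
  rw [h2.derivWithin (uniqueDiffOn_Icc hT t ht), add_sub_cancel_right]

include hA hu hM1 hM hT hb

theorem IsLinearFlow.norm_sub_le {t τ : ℝ} (ht : t ∈ Icc 0 T) (hτ : τ ∈ Icc 0 T) {v₀ : X} {v : ℝ → X}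
    (hv : IsLinearFlow A B b τ v₀ v) :
    ‖v τ - u t‖ ≤ M * (2 * L) * τ + M * ‖v₀ - u t‖ := by
  have h2 : ‖derivWithin u (Icc 0 T) t - f (u t)‖ ≤ 2 * L := by
    have h3 := (hb.local_bounds t ht).norm_le (u t) (Metric.mem_ball_self hb.pos)
    linarith [_root_.norm_sub_le (derivWithin u (Icc 0 T) t) (f (u t)), hb.norm_deriv_le t ht]
  rw [hv.eq hS hA (hu.hasImageAndBoundaryValue hT ht) hτ.1, add_sub_cancel_left]
  refine (norm_add_le _ _).trans (add_le_add ?_ ((S τ).le_of_opNorm_le (hM τ hτ) _))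
  refine (IsContinuousSemigroup.norm_integral_le hM hτ _).trans ?_
  have := hτ.1
  gcongr

/-- The radius needed before the last half step is made up of at most MLτ/2 from the first half
step, 2MLτ from the linear flow (A (u t) = u' - f has norm at most 2L) and Lτ for the last half
step; 4MLτ covers all of them. -/
theorem exists_isStrangStep {t τ : ℝ} (ht : t ∈ Icc 0 T) (hτ : τ ∈ Icc 0 T) {x₀ : X}
    (hx₀ : M * ‖x₀ - u t‖ + 4 * M * L * τ < ρ) : ∃ y, IsStrangStep A B b f τ x₀ y := by
  have hτ0 := hτ.1
  have hL := hb.one_le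
  have hb' := hb.local_bounds t ht
  have hp : 0 ≤ (M - 1) * (L * τ) := mul_nonneg (by linarith) (by positivity)
  have hp' : 0 ≤ (M - 1) * ‖x₀ - u t‖ := mul_nonneg (by linarith) (by positivity)
  have hp2 : 0 ≤ L * τ := by positivity
  have hσ : ‖x₀ - u t‖ + 2 * L * (τ / 2) < ρ := by nlinarith
  obtain ⟨w, hw⟩ := hb'.exists_isReactionFlow hσ (by positivity)
  have hv := isLinearFlow_of_hasImageAndBoundaryValue hS hA (hu.hasImageAndBoundaryValue hT ht) τ
    (w (τ / 2))
  have h1 := hv.norm_sub_le hS hA hu hM1 hM hT hb ht hτ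
  have h2 := hw.norm_sub_center_le hb' hσ (s := τ / 2) ⟨by positivity, le_rfl⟩
  have h3 : M * ‖w (τ / 2) - u t‖ ≤ M * (‖x₀ - u t‖ + L * (τ / 2)) := by gcongr
  obtain ⟨z, hz⟩ := hb'.exists_isReactionFlow (σ := τ / 2) (lt_of_le_of_lt (add_le_add_left h1 _)
    (by nlinarith)) (by positivity)
  exact ⟨_, w, _, z, hw, hv, hz, rfl⟩

/-- The boundary data cancel in the difference of two linear flows. S τ is kept as an operator: its
norm is only bounded by M, and the powers of M would grow with the number of steps. -/
theorem IsStrangStep.norm_sub_sub_le {t τ : ℝ} (ht : t ∈ Icc 0 T) (hτ : τ ∈ Icc 0 T)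
    (hLτ : L * τ ≤ 1) {x₀ x₁ y₀ y₁ : X}
    (hx₀ : M * ‖x₀ - u t‖ + 4 * M * L * τ < ρ) (hx₁ : M * ‖x₁ - u t‖ + 4 * M * L * τ < ρ)
    (hy₀ : IsStrangStep A B b f τ x₀ y₀) (hy₁ : IsStrangStep A B b f τ x₁ y₁) :
    ‖y₀ - y₁ - S τ (x₀ - x₁)‖ ≤ 6 * M * L * τ * ‖x₀ - x₁‖ := by
  have hτ0 := hτ.1
  have hL := hb.one_le
  have hb' := hb.local_bounds t ht
  have hp : 0 ≤ (M - 1) * (L * τ) := mul_nonneg (by linarith) (by positivity)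
  have hp2 : 0 ≤ L * τ := by positivity
  have hτ2 : τ / 2 ∈ Icc 0 (τ / 2) := ⟨by positivity, le_rfl⟩
  have aux : ∀ {x₀ : X} {w v : ℝ → X}, M * ‖x₀ - u t‖ + 4 * M * L * τ < ρ →
      IsReactionFlow f (τ / 2) x₀ w → IsLinearFlow A B b τ (w (τ / 2)) v →
      ‖x₀ - u t‖ + 2 * L * (τ / 2) < ρ ∧ ‖v τ - u t‖ + 2 * L * (τ / 2) < ρ := by
    intro x₀ w v hx₀ hw hv
    have hp' : 0 ≤ (M - 1) * ‖x₀ - u t‖ := mul_nonneg (by linarith) (by positivity)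
    have hσ : ‖x₀ - u t‖ + 2 * L * (τ / 2) < ρ := by nlinarith
    have h1 := hv.norm_sub_le hS hA hu hM1 hM hT hb ht hτ
    have h2 := hw.norm_sub_center_le hb' hσ hτ2
    have h3 : M * ‖w (τ / 2) - u t‖ ≤ M * (‖x₀ - u t‖ + L * (τ / 2)) := by gcongr
    exact ⟨hσ, by nlinarith⟩
  obtain ⟨w₀, v₀, z₀, hw₀, hv₀, hz₀, rfl⟩ := hy₀
  obtain ⟨w₁, v₁, z₁, hw₁, hv₁, hz₁, rfl⟩ := hy₁
  have h1 := hw₀.norm_sub_sub_le hw₁ hb' (aux hx₀ hw₀ hv₀).1 (aux hx₁ hw₁ hv₁).1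
    hτ2.1 (by linarith)
  have h2 := hz₀.norm_sub_sub_le hz₁ hb' (aux hx₀ hw₀ hv₀).2 (aux hx₁ hw₁ hv₁).2
    hτ2.1 (by linarith)
  have hv : v₀ τ - v₁ τ = S τ (w₀ (τ / 2) - w₁ (τ / 2)) := by
    rw [hv₀.eq hS hA (hu.hasImageAndBoundaryValue hT ht) hτ.1,
      hv₁.eq hS hA (hu.hasImageAndBoundaryValue hT ht) hτ.1]
    simp only [map_sub]
    abel
  set e₁ := w₀ (τ / 2) - w₁ (τ / 2) - (x₀ - x₁)
  have hw : w₀ (τ / 2) - w₁ (τ / 2) = (x₀ - x₁) + e₁ := by simp only [e₁]; abel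
  have h3 : ‖S τ e₁‖ ≤ M * (3 * L * (τ / 2) * ‖x₀ - x₁‖) :=
    ((S τ).le_of_opNorm_le (hM τ hτ) _).trans (by gcongr)
  have h4 : ‖v₀ τ - v₁ τ‖ ≤ M * ‖x₀ - x₁‖ + M * (3 * L * (τ / 2) * ‖x₀ - x₁‖) := by
    rw [hv, hw, map_add]
    exact (norm_add_le _ _).trans (add_le_add ((S τ).le_of_opNorm_le (hM τ hτ) _) h3)
  have e : z₀ (τ / 2) - z₁ (τ / 2) - S τ (x₀ - x₁)
      = (z₀ (τ / 2) - z₁ (τ / 2) - (v₀ τ - v₁ τ)) + S τ e₁ := by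
    rw [hv, hw, map_add]
    abel
  rw [e]
  refine (norm_add_le _ _).trans ((add_le_add h2 h3).trans ?_)
  have h5 : 0 ≤ M * ‖x₀ - x₁‖ := by positivity
  calc _ ≤ 3 * L * (τ / 2) * (M * ‖x₀ - x₁‖ + M * (3 * L * (τ / 2) * ‖x₀ - x₁‖))
        + M * (3 * L * (τ / 2) * ‖x₀ - x₁‖) := by gcongr
    _ = (3 * (L * τ) + 9 / 4 * (L * τ) * (L * τ)) * (M * ‖x₀ - x₁‖) := by ring
    _ ≤ (3 * (L * τ) + 9 / 4 * 1 * (L * τ)) * (M * ‖x₀ - x₁‖) := by gcongr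
    _ ≤ 6 * (L * τ) * (M * ‖x₀ - x₁‖) := by gcongr; linarith
    _ = _ := by ring

end LocalErrorExpansion

/-! ### Expansion of the local error -/

section LocalErrorBounds

variable {X Y : Type*} [NormedAddCommGroup X] [NormedSpace ℝ X] [AddCommGroup Y] [Module ℝ Y]

section Duhamel

variable {f : X → X} {T : ℝ} {u : ℝ → X} {M ρ L : ℝ} (hb : TrajectoryBounds f u T ρ L)
include hb

theorem TrajectoryBounds.mem_ball {t s : ℝ} (ht : t ∈ Icc 0 T) (hs : 0 ≤ s) (hts : t + s ≤ T)
    (hρ : L * s < ρ) : u (t + s) ∈ Metric.ball (u t) ρ := by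
  have := hb.norm_sub_le t ht (t + s) ⟨by linarith [ht.1], hts⟩
  rw [add_sub_cancel_left, abs_of_nonneg hs] at this
  rw [Metric.mem_ball, dist_eq_norm]
  linarith

theorem TrajectoryBounds.norm_apply_sub_le {t s : ℝ} (ht : t ∈ Icc 0 T) (hs : 0 ≤ s)
    (hts : t + s ≤ T) (hρ : L * s < ρ) : ‖f (u (t + s)) - f (u t)‖ ≤ L ^ 2 * s := by
  have hL := hb.one_le
  have h1 := hb.norm_sub_le t ht (t + s) ⟨by linarith [ht.1], hts⟩
  rw [add_sub_cancel_left, abs_of_nonneg hs] at h1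
  refine ((hb.local_bounds t ht).norm_sub_le _ (hb.mem_ball ht hs hts hρ) _
    (Metric.mem_ball_self hb.pos)).trans ?_
  rw [sq, mul_assoc]
  gcongr

theorem TrajectoryBounds.norm_apply_sub_sub_le {t s : ℝ} (ht : t ∈ Icc 0 T) (hs : 0 ≤ s)
    (hts : t + s ≤ T) (hρ : L * s < ρ) :
    ‖f (u (t + s)) - f (u t) - s • fderiv ℝ f (u t) (derivWithin u (Icc 0 T) t)‖
      ≤ 2 * L ^ 3 * s ^ 2 := by
  have hL := hb.one_le
  have hts' : t + s ∈ Icc 0 T := ⟨by linarith [ht.1], hts⟩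
  have hb' := hb.local_bounds t ht
  have h1 := hb.norm_sub_le t ht (t + s) hts'
  have h2 := hb.taylor t ht (t + s) hts' (by linarith)
  rw [add_sub_cancel_left] at h1 h2
  rw [abs_of_nonneg hs] at h1
  have h3 := hb'.taylor _ (hb.mem_ball ht hs hts hρ)
  have h4 := (fderiv ℝ f (u t)).le_of_opNorm_le hb'.norm_fderiv_le
    (u (t + s) - u t - s • derivWithin u (Icc 0 T) t)
  have e : f (u (t + s)) - f (u t) - s • fderiv ℝ f (u t) (derivWithin u (Icc 0 T) t)
      = (f (u (t + s)) - f (u t) - fderiv ℝ f (u t) (u (t + s) - u t))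
        + fderiv ℝ f (u t) (u (t + s) - u t - s • derivWithin u (Icc 0 T) t) := by
    simp only [map_sub, map_smul]
    abel
  rw [e]
  refine (norm_add_le _ _).trans ?_
  have hL2 : L ^ 2 ≤ L ^ 3 := pow_le_pow_right₀ hL (by norm_num)
  calc _ ≤ L * (L * s) ^ 2 + L * (L * s ^ 2) :=
        add_le_add (h3.trans (by gcongr)) (h4.trans (by gcongr))
    _ = L ^ 3 * s ^ 2 + L ^ 2 * s ^ 2 := by ring
    _ ≤ L ^ 3 * s ^ 2 + L ^ 3 * s ^ 2 := by gcongr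
    _ = _ := by ring

variable [CompleteSpace X] {S : ℝ → X →L[ℝ] X} (hS : IsContinuousSemigroup S)
  (hM : ∀ t ∈ Icc 0 T, ‖S t‖ ≤ M) (hfu : ContinuousOn (fun s => f (u s)) (Icc 0 T))
include hS hM hfu

omit hM hb in
theorem continuousOn_duhamel {t τ : ℝ} (ht : 0 ≤ t) (htτ : t + τ ≤ T) :
    ContinuousOn (fun s => S (τ - s) (f (u (t + s)))) (Icc 0 τ) := by
  have hcf : ContinuousOn (fun s => f (u (t + s))) (Icc 0 τ) :=
    hfu.comp (by fun_prop : ContinuousOn (fun s : ℝ => t + s) (Icc 0 τ))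
      fun s hs => ⟨by linarith [hs.1], by linarith [hs.2]⟩
  exact hS.continuous_uncurry.comp_continuousOn (f := fun s => (τ - s, f (u (t + s))))
    ((by fun_prop : Continuous fun s : ℝ => τ - s).continuousOn.prodMk hcf)

theorem TrajectoryBounds.norm_duhamel_sub_le {t τ : ℝ} (ht : 0 ≤ t) (hτ : 0 ≤ τ) (htτ : t + τ ≤ T)
    (hρ : L * τ < ρ) :
    ‖(∫ s in (0 : ℝ)..τ, S (τ - s) (f (u (t + s)))) - ∫ s in (0 : ℝ)..τ, S s (f (u t))‖
      ≤ M * L ^ 2 * τ ^ 2 := by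
  have hL := hb.one_le
  have hM0 : 0 ≤ M := (norm_nonneg _).trans (hM t ⟨ht, by linarith⟩)
  have hc := continuousOn_duhamel hS hfu ht htτ
  have hc' : Continuous fun s => S (τ - s) (f (u t)) :=
    (hS.continuous _).comp (continuous_const.sub continuous_id)
  have e : ∫ s in (0 : ℝ)..τ, S s (f (u t)) = ∫ s in (0 : ℝ)..τ, S (τ - s) (f (u t)) := by
    rw [intervalIntegral.integral_comp_sub_left (fun s => S s (f (u t)))]
    simp
  rw [e, ← intervalIntegral.integral_sub (hc.intervalIntegrable_of_Icc hτ)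
    (hc'.intervalIntegrable _ _)]
  refine (norm_integral_le_mul hτ (C := M * (L ^ 2 * τ)) (hc.sub hc'.continuousOn)
    fun s hs => ?_).trans (by linarith [sq τ])
  simp only [Pi.sub_apply]
  rw [← map_sub]
  refine ((S _).le_of_opNorm_le (hM _ ⟨by linarith [hs.2], by linarith [hs.1]⟩) _).trans ?_
  have hLs : L * s ≤ L * τ := by gcongr; exact hs.2
  gcongr
  refine (hb.norm_apply_sub_le ⟨ht, by linarith⟩ hs.1 (by linarith [hs.2]) (by linarith)).trans ?_
  gcongr
  exact hs.2

theorem TrajectoryBounds.norm_duhamel_sub_sub_le {t τ : ℝ} (ht : 0 ≤ t) (hτ : 0 ≤ τ)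
    (htτ : t + τ ≤ T) (hρ : L * τ < ρ) :
    ‖(∫ s in (0 : ℝ)..τ, S (τ - s) (f (u (t + s)))) - (∫ s in (0 : ℝ)..τ, S s (f (u t)))
      - ∫ s in (0 : ℝ)..τ, s • S (τ - s) (fderiv ℝ f (u t) (derivWithin u (Icc 0 T) t))‖
      ≤ 2 * M * L ^ 3 * τ ^ 3 := by
  have hL := hb.one_le
  have hM0 : 0 ≤ M := (norm_nonneg _).trans (hM t ⟨ht, by linarith⟩)
  set q := fderiv ℝ f (u t) (derivWithin u (Icc 0 T) t)
  have hc := continuousOn_duhamel hS hfu ht htτ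
  have hc' : Continuous fun s => S (τ - s) (f (u t)) :=
    (hS.continuous _).comp (continuous_const.sub continuous_id)
  have hcq : Continuous fun s : ℝ => s • S (τ - s) q :=
    continuous_id.smul ((hS.continuous _).comp (continuous_const.sub continuous_id))
  have e : ∫ s in (0 : ℝ)..τ, S s (f (u t)) = ∫ s in (0 : ℝ)..τ, S (τ - s) (f (u t)) := by
    rw [intervalIntegral.integral_comp_sub_left (fun s => S s (f (u t)))]
    simp
  rw [e, ← intervalIntegral.integral_sub (hc.intervalIntegrable_of_Icc hτ)
    (hc'.intervalIntegrable _ _), ← intervalIntegral.integral_sub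
    ((hc.intervalIntegrable_of_Icc hτ).sub (hc'.intervalIntegrable _ _))
    (hcq.intervalIntegrable _ _)]
  refine (norm_integral_le_mul hτ (C := M * (2 * L ^ 3 * τ ^ 2))
    ((hc.sub hc'.continuousOn).sub hcq.continuousOn) fun s hs => ?_).trans (by linarith [pow_succ τ 2])
  simp only [Pi.sub_apply]
  rw [← map_smul, ← map_sub, ← map_sub]
  refine ((S _).le_of_opNorm_le (hM _ ⟨by linarith [hs.2], by linarith [hs.1]⟩) _).trans ?_
  have hLs : L * s ≤ L * τ := by gcongr; exact hs.2
  gcongr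
  refine (hb.norm_apply_sub_sub_le ⟨ht, by linarith⟩ hs.1 (by linarith [hs.2])
    (by linarith)).trans ?_
  have := hs.1
  gcongr
  exact hs.2

end Duhamel

variable [CompleteSpace X] {S : ℝ → X →L[ℝ] X} (hS : IsContinuousSemigroup S)
  {A : X →ₗ.[ℝ] X} {B : A.domain →ₗ[ℝ] Y} {b : Y} {f : X → X}
  (hA : IsGenerator (dirichletRealization A B) S) {T : ℝ} {u : ℝ → X}
  (hu : IsExactSolution A B b f T u) {M ρ L : ℝ} (hM1 : 1 ≤ M) (hM : ∀ t ∈ Icc 0 T, ‖S t‖ ≤ M)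
  (hT : 0 < T) (hb : TrajectoryBounds f u T ρ L)
  (hfu : ContinuousOn (fun s => f (u s)) (Icc 0 T))
include hS hA hu hT hfu

/-- Both formulas are written with the same lift u t, so the terms with A (u t) cancel and no
regularity of A (u t) in space is required. -/
theorem IsLinearFlow.sub_eq {t τ : ℝ} (ht : 0 ≤ t) (hτ : 0 ≤ τ) (htτ : t + τ ≤ T)
    {v₀ : X} {v : ℝ → X} (hv : IsLinearFlow A B b τ v₀ v) :
    v τ - u (t + τ) = S τ (v₀ - u t) - ∫ s in (0 : ℝ)..τ, S (τ - s) (f (u (t + s))) := by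
  have hx := hu.hasImageAndBoundaryValue hT (t := t) ⟨ht, by linarith⟩
  rw [hv.eq hS hA hx hτ, hu.eq_add_integral hS hA ht hτ htτ hfu hx]
  abel

include hM1 hM hb

/-- The expansion of the local error to first order, without any condition on the boundary. -/
theorem IsStrangStep.norm_sub_trapezoidalError_le {t τ : ℝ} (ht : 0 ≤ t) (hτ : 0 ≤ τ)
    (htτ : t + τ ≤ T) (hρ : 4 * M * L * τ < ρ) {y : X} (hy : IsStrangStep A B b f τ (u t) y) :
    ‖y - u (t + τ) - trapezoidalError S τ (f (u t))‖ ≤ 4 * M * L ^ 2 * τ ^ 2 := by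
  have hL := hb.one_le
  have htT : t ∈ Icc 0 T := ⟨ht, by linarith⟩
  have hτT : τ ∈ Icc 0 T := ⟨hτ, by linarith⟩
  have hb' := hb.local_bounds t htT
  have hp : 0 ≤ (M - 1) * (L * τ) := mul_nonneg (by linarith) (by positivity)
  have hp2 : 0 ≤ L * τ := by positivity
  have hτ2 : τ / 2 ∈ Icc 0 (τ / 2) := ⟨by positivity, le_rfl⟩
  obtain ⟨w, v, z, hw, hv, hz, rfl⟩ := hy
  have hσ : ‖u t - u t‖ + 2 * L * (τ / 2) < ρ := by rw [sub_self, norm_zero]; nlinarith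
  have hw1 := hw.norm_sub_le hb' hσ hτ2
  have hw2 := hw.norm_sub_smul_le hb' hσ hτ2
  have hv1 := hv.norm_sub_le hS hA hu hM1 hM hT hb htT hτT
  have hv2 := hv.sub_eq hS hA hu hT hfu ht hτ htτ
  have hδ : ‖v τ - u t‖ + L * (τ / 2) ≤ 4 * M * L * τ := by
    have : M * ‖w (τ / 2) - u t‖ ≤ M * (L * (τ / 2)) := by gcongr
    nlinarith
  have hδ' : ‖v τ - u t‖ + 2 * L * (τ / 2) < ρ := by
    have : M * ‖w (τ / 2) - u t‖ ≤ M * (L * (τ / 2)) := by gcongr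
    nlinarith
  have hz1 := hz.norm_sub_smul_le hb' hδ' hτ2
  have hI := hb.norm_duhamel_sub_le hS hM hfu ht hτ htτ (by nlinarith)
  set I := ∫ s in (0 : ℝ)..τ, S (τ - s) (f (u (t + s)))
  set J := ∫ s in (0 : ℝ)..τ, S s (f (u t)) with hJ
  rw [sub_self, norm_zero, zero_add] at hw2
  -- The two half steps give the endpoint values of the trapezoidal rule and the Duhamel integral
  -- gives the integral; the three differences are remainders.
  have e : z (τ / 2) - u (t + τ) - trapezoidalError S τ (f (u t))
      = (z (τ / 2) - v τ - (τ / 2) • f (u t)) + S τ (w (τ / 2) - u t - (τ / 2) • f (u t))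
        - (I - J) := by
    have e1 : z (τ / 2) - u (t + τ) = z (τ / 2) - v τ + (v τ - u (t + τ)) := by abel
    rw [e1, hv2, trapezoidalError, ← hJ]
    simp only [map_sub, map_smul]
    module
  rw [e]
  refine (_root_.norm_sub_le _ _).trans ((add_le_add ((norm_add_le _ _).trans
    (add_le_add hz1 ((S τ).le_of_opNorm_le (hM τ hτT) _))) hI).trans ?_)
  calc _ ≤ L * (4 * M * L * τ) * (τ / 2) + M * (L * (L * (τ / 2)) * (τ / 2))
        + M * L ^ 2 * τ ^ 2 := by gcongr
    _ = (13 / 4) * (M * L ^ 2 * τ ^ 2) := by ring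
    _ ≤ 4 * (M * L ^ 2 * τ ^ 2) := by gcongr; norm_num
    _ = _ := by ring

/-- The expansion of the local error to second order, for a reaction `f (u t)` whose orbit under
the semigroup is Lipschitz continuous. -/
theorem IsStrangStep.norm_sub_trapezoidalError_sub_le {t τ : ℝ} (ht : 0 ≤ t) (hτ : 0 ≤ τ)
    (htτ : t + τ ≤ T) (hρ : 4 * M * L * τ < ρ) {κ : ℝ}
    (hκ : ∀ r ∈ Icc 0 τ, ‖S r (f (u t)) - f (u t)‖ ≤ κ * τ)
    {y : X} (hy : IsStrangStep A B b f τ (u t) y) :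
    ‖y - u (t + τ) - (trapezoidalError S τ (f (u t))
      + (τ ^ 2 / 8) • (S τ (fderiv ℝ f (u t) (f (u t))) - fderiv ℝ f (u t) (f (u t)))
      - ∫ s in (0 : ℝ)..τ, s • (S (τ - s) (fderiv ℝ f (u t) (derivWithin u (Icc 0 T) t))
        - fderiv ℝ f (u t) (derivWithin u (Icc 0 T) t)))‖
      ≤ (20 * M ^ 2 * L ^ 3 + κ * L) * τ ^ 3 := by
  have hL := hb.one_le
  have htT : t ∈ Icc 0 T := ⟨ht, by linarith⟩
  have hτT : τ ∈ Icc 0 T := ⟨hτ, by linarith⟩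
  have hb' := hb.local_bounds t htT
  have hp : 0 ≤ (M - 1) * (L * τ) := mul_nonneg (by linarith) (by positivity)
  have hp2 : 0 ≤ L * τ := by positivity
  have hτ2 : τ / 2 ∈ Icc 0 (τ / 2) := ⟨by positivity, le_rfl⟩
  obtain ⟨w, v, z, hw, hv, hz, rfl⟩ := hy
  have hσ : ‖u t - u t‖ + 2 * L * (τ / 2) < ρ := by rw [sub_self, norm_zero]; nlinarith
  have hw1 := hw.norm_sub_le hb' hσ hτ2
  have hw2 := hw.norm_sub_smul_le hb' hσ hτ2
  have hw3 := hw.taylor hb' hσ hτ2.1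
  have hv1 := hv.norm_sub_le hS hA hu hM1 hM hT hb htT hτT
  have hv2 := hv.sub_eq hS hA hu hT hfu ht hτ htτ
  have hδ : ‖v τ - u t‖ + L * (τ / 2) ≤ 4 * M * L * τ := by
    have : M * ‖w (τ / 2) - u t‖ ≤ M * (L * (τ / 2)) := by gcongr
    nlinarith
  have hδ' : ‖v τ - u t‖ + 2 * L * (τ / 2) < ρ := by
    have : M * ‖w (τ / 2) - u t‖ ≤ M * (L * (τ / 2)) := by gcongr
    nlinarith
  have hz1 := hz.taylor hb' hδ' hτ2.1
  have hLρ : L * τ < ρ := by nlinarith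
  have hI := hb.norm_duhamel_sub_le hS hM hfu ht hτ htτ hLρ
  have hI2 := hb.norm_duhamel_sub_sub_le hS hM hfu ht hτ htτ hLρ
  have hut := hb.taylor t htT (t + τ) ⟨by linarith, htτ⟩ (by linarith)
  rw [add_sub_cancel_left] at hut
  have hJ' := norm_integral_le_mul hτ (hS.continuous_apply_sub (f (u t))).continuousOn hκ
  rw [intervalIntegral.integral_sub (hS.intervalIntegrable _ _ _) (by simp),
    intervalIntegral.integral_const, sub_zero] at hJ'
  set I := ∫ s in (0 : ℝ)..τ, S (τ - s) (f (u (t + s)))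
  set J := ∫ s in (0 : ℝ)..τ, S s (f (u t)) with hJ
  set D := fderiv ℝ f (u t)
  set u' := derivWithin u (Icc 0 T) t
  set y₀ := f (u t)
  have hcq : Continuous fun s : ℝ => s • S (τ - s) (D u') :=
    continuous_id.smul ((hS.continuous _).comp (continuous_const.sub continuous_id))
  have hQ : ∫ s in (0 : ℝ)..τ, s • (S (τ - s) (D u') - D u')
      = (∫ s in (0 : ℝ)..τ, s • S (τ - s) (D u')) - (τ ^ 2 / 2) • D u' := by
    simp only [smul_sub]
    rw [intervalIntegral.integral_sub (hcq.intervalIntegrable _ _)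
      ((by fun_prop : Continuous fun s : ℝ => s • D u').intervalIntegrable _ _),
      intervalIntegral.integral_smul_const, integral_id]
    simp
  rw [hQ]
  set Q := ∫ s in (0 : ℝ)..τ, s • S (τ - s) (D u')
  rw [sub_self, norm_zero, zero_add] at hw2 hw3
  rw [map_zero, add_zero] at hw3
  set r₀ := w (τ / 2) - u t - (τ / 2) • y₀ with hr₀
  have hr₀' : ‖r₀‖ ≤ L ^ 2 / 4 * τ ^ 2 := hw2.trans (by apply le_of_eq; ring)
  -- The linear flow ends at v τ = u t + τ u' - (τ/2) f (u t) + r₂ + r₃ with remainders of size τ².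
  -- For r₂ this uses `hκ`, which allows S r (f (u t)) to be replaced by f (u t).
  set r₂ := S τ r₀ + (τ / 2) • (S τ y₀ - y₀) - (I - J) - (J - τ • y₀) with hr₂
  set r₃ := u (t + τ) - u t - τ • u' with hr₃
  have hvx : v τ - u t = τ • u' - (τ / 2) • y₀ + (r₂ + r₃) := by
    have e1 : v τ - u t = v τ - u (t + τ) + (u (t + τ) - u t) := by abel
    rw [e1, hv2, hr₂, hr₃, hr₀]
    simp only [map_sub, map_smul]
    module
  have hr₂' : ‖r₂‖ ≤ (5 / 4 * M * L ^ 2 + 3 / 2 * κ) * τ ^ 2 := by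
    have n1 : ‖S τ r₀‖ ≤ M * (L ^ 2 / 4 * τ ^ 2) :=
      ((S τ).le_of_opNorm_le (hM τ hτT) _).trans (by gcongr)
    have n2 : ‖(τ / 2) • (S τ y₀ - y₀)‖ ≤ τ / 2 * (κ * τ) := by
      rw [norm_smul, Real.norm_of_nonneg hτ2.1]
      gcongr
      exact hκ τ ⟨hτ, le_rfl⟩
    have n3 := _root_.norm_sub_le (S τ r₀ + (τ / 2) • (S τ y₀ - y₀) - (I - J)) (J - τ • y₀)
    have n4 := _root_.norm_sub_le (S τ r₀ + (τ / 2) • (S τ y₀ - y₀)) (I - J)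
    have n5 := norm_add_le (S τ r₀) ((τ / 2) • (S τ y₀ - y₀))
    calc ‖r₂‖ ≤ M * (L ^ 2 / 4 * τ ^ 2) + τ / 2 * (κ * τ) + M * L ^ 2 * τ ^ 2 + κ * τ * τ := by
          linarith
      _ = _ := by ring
  -- The second half step contributes (τ²/2) D u' - (τ²/4 - τ²/8) D y₀, the first one (τ²/8) S τ (D
  -- y₀); together with the Duhamel term these form the differences with S - 1.
  have e : z (τ / 2) - u (t + τ) - (trapezoidalError S τ y₀
        + (τ ^ 2 / 8) • (S τ (D y₀) - D y₀) - (Q - (τ ^ 2 / 2) • D u'))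
      = (z (τ / 2) - v τ - ((τ / 2) • (y₀ + D (v τ - u t)) + ((τ / 2) ^ 2 / 2) • D y₀))
        + S τ (w (τ / 2) - u t - ((τ / 2) • y₀ + ((τ / 2) ^ 2 / 2) • D y₀))
        - (I - J - Q) + (τ / 2) • D (r₂ + r₃) := by
    have e1 : z (τ / 2) - u (t + τ) = z (τ / 2) - v τ + (v τ - u (t + τ)) := by abel
    have e2 : D (v τ - u t) = τ • D u' - (τ / 2) • D y₀ + D (r₂ + r₃) := by
      rw [hvx]
      simp only [map_add, map_sub, map_smul]
    rw [e1, hv2, e2, trapezoidalError, ← hJ]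
    simp only [map_sub, map_smul, map_add]
    module
  rw [e]
  have b1 := (S τ).le_of_opNorm_le (hM τ hτT)
    (w (τ / 2) - u t - ((τ / 2) • y₀ + ((τ / 2) ^ 2 / 2) • D y₀))
  have b2 : ‖(τ / 2) • D (r₂ + r₃)‖
      ≤ τ / 2 * (L * ((5 / 4 * M * L ^ 2 + 3 / 2 * κ) * τ ^ 2 + L * τ ^ 2)) := by
    rw [norm_smul, Real.norm_of_nonneg hτ2.1]
    gcongr
    refine (D.le_of_opNorm_le hb'.norm_fderiv_le _).trans ?_
    gcongr
    exact (norm_add_le _ _).trans (add_le_add hr₂' hut)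
  refine (norm_add_le _ _).trans ((add_le_add ((_root_.norm_sub_le _ _).trans
    (add_le_add ((norm_add_le _ _).trans (add_le_add hz1 b1)) hI2)) b2).trans ?_)
  have hLM : M * L ^ 3 * τ ^ 3 ≤ M ^ 2 * L ^ 3 * τ ^ 3 := by
    gcongr
    exact le_self_pow₀ hM1 (by norm_num)
  have hLL : L ^ 2 * τ ^ 3 ≤ M ^ 2 * L ^ 3 * τ ^ 3 := by
    have : L ^ 2 ≤ M ^ 2 * L ^ 3 := by
      calc L ^ 2 ≤ L ^ 3 := pow_le_pow_right₀ hL (by norm_num)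
        _ ≤ M ^ 2 * L ^ 3 := le_mul_of_one_le_left (by positivity) (one_le_pow₀ hM1)
    gcongr
  have hκ0 : 0 ≤ κ * L * τ ^ 3 := by
    have := (norm_nonneg _).trans (hκ τ ⟨hτ, le_rfl⟩)
    have h6 : κ * L * τ ^ 3 = κ * τ * (L * τ ^ 2) := by ring
    rw [h6]
    positivity
  calc _ ≤ 2 * L * (4 * M * L * τ) ^ 2 * (τ / 2) + M * (2 * L * (L * (τ / 2)) ^ 2 * (τ / 2))
        + 2 * M * L ^ 3 * τ ^ 3
        + τ / 2 * (L * ((5 / 4 * M * L ^ 2 + 3 / 2 * κ) * τ ^ 2 + L * τ ^ 2)) := by gcongr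
    _ = 16 * (M ^ 2 * L ^ 3 * τ ^ 3) + (23 / 8) * (M * L ^ 3 * τ ^ 3) + (1 / 2) * (L ^ 2 * τ ^ 3)
        + 3 / 4 * (κ * L * τ ^ 3) := by ring
    _ ≤ _ := by linarith [show 0 ≤ M ^ 2 * L ^ 3 * τ ^ 3 by positivity]

end LocalErrorBounds

/-! ### Bounds for the defects, plain and smoothed, in the three cases -/

section DefectBounds

variable {X Y : Type*} [NormedAddCommGroup X] [NormedSpace ℝ X] [AddCommGroup Y] [Module ℝ Y]
  [CompleteSpace X]

section Orbit

variable {S : ℝ → X →L[ℝ] X} (hS : IsContinuousSemigroup S) {A₀ : X →ₗ.[ℝ] X}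
  (hA : IsGenerator A₀ S) {T M : ℝ} (hM : ∀ t ∈ Icc 0 T, ‖S t‖ ≤ M)
include hS hA hM

theorem IsContinuousSemigroup.norm_apply_sub_le {x y : X} (hxy : (x, y) ∈ A₀.graph) {r : ℝ}
    (hr : r ∈ Icc 0 T) : ‖S r x - x‖ ≤ M * ‖y‖ * r := by
  rw [hS.apply_sub_eq_integral hA hxy hr.1]
  exact norm_integral_le hM hr y

/-- The limit q need not belong to the domain of `A₀`; the Lipschitz bound of the orbits alone
passes to the limit. -/
theorem IsContinuousSemigroup.norm_apply_sub_le_of_tendsto {ι : Type*} {l : Filter ι} [l.NeBot]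
    {x y : ι → X} {q : X} (hx : Tendsto x l (𝓝 q)) {K : ℝ} (hM0 : 0 ≤ M)
    (hxy : ∀ᶠ i in l, (x i, y i) ∈ A₀.graph ∧ ‖y i‖ ≤ K) {r : ℝ} (hr : r ∈ Icc 0 T) :
    ‖S r q - q‖ ≤ M * K * r := by
  refine le_of_tendsto ((((S r).continuous.tendsto q).comp hx).sub hx).norm ?_
  filter_upwards [hxy] with i hi
  refine (hS.norm_apply_sub_le hA hM hi.1 hr).trans ?_
  have := hr.1
  gcongr
  exact hi.2

/-- S r x - x is A₀ applied to the integral of the orbit over [0, r], whose norm is at most M ‖x‖ r.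
This gives a factor r/t for every x in X. -/
theorem ParabolicSmoothing.exists_norm_le (hP : ParabolicSmoothing A₀ S T) :
    ∃ C ≥ 0, ∀ t ∈ Ioc 0 T, ∀ r ∈ Icc 0 T, ∀ x, ‖S t (S r x - x)‖ ≤ C / t * (M * ‖x‖ * r) := by
  obtain ⟨C, hC⟩ := hP
  refine ⟨|C|, abs_nonneg C, fun t ht r hr x => ?_⟩
  obtain ⟨z, hz1, hz2⟩ := (LinearPMap.mem_graph_iff _).1 (hS.integral_mem_graph hA hr.1 x)
  have h1 := hC t ht z
  simp only at hz1 hz2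
  rw [hz2, hz1] at h1
  have := ht.1
  calc _ ≤ C / t * ‖∫ s in (0 : ℝ)..r, S s x‖ := h1
    _ ≤ |C| / t * (M * ‖x‖ * r) := by
      gcongr
      · exact le_abs_self C
      · exact IsContinuousSemigroup.norm_integral_le hM hr x

end Orbit

variable {S : ℝ → X →L[ℝ] X} (hS : IsContinuousSemigroup S)
  {A : X →ₗ.[ℝ] X} {B : A.domain →ₗ[ℝ] Y} {b : Y} {f : X → X}
  (hA : IsGenerator (dirichletRealization A B) S) {T : ℝ} {u : ℝ → X}
  (hu : IsExactSolution A B b f T u) {M ρ L : ℝ} (hM1 : 1 ≤ M) (hM : ∀ t ∈ Icc 0 T, ‖S t‖ ≤ M)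
  (hT : 0 < T) (hb : TrajectoryBounds f u T ρ L)
  (hfu : ContinuousOn (fun s => f (u s)) (Icc 0 T))

omit [CompleteSpace X] in
theorem ReactionVanishesOnBoundary.mem_graph (hf : ReactionVanishesOnBoundary A B b f) {x y z : X}
    (hx : HasImageAndBoundaryValue A B x y b) (hz : (f x, z) ∈ A.graph) :
    (f x, z) ∈ (dirichletRealization A B).graph := by
  obtain ⟨w, hw, rfl⟩ := (LinearPMap.mem_graph_iff _).1 hz
  obtain ⟨h, hb, -⟩ := hx
  simp only at hw
  refine mem_graph_dirichletRealization_iff.2 ⟨hw ▸ w.2, hf x ⟨h, hb⟩ _, ?_⟩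
  congr 1
  exact Subtype.ext hw.symm

include hS hM1 hM

omit [CompleteSpace X] hS in
theorem norm_apply_sub_le_of_norm_le {r : ℝ} (hr : r ∈ Icc 0 T) (x : X) :
    ‖S r x - x‖ ≤ 2 * M * ‖x‖ := by
  have h1 := (S r).le_of_opNorm_le (hM r hr) x
  have h2 : 1 * ‖x‖ ≤ M * ‖x‖ := by gcongr
  linarith [_root_.norm_sub_le (S r x) x]

include hA hu hT hb hfu

theorem exists_defect_bound_order_one : ∃ C, ∀ τ > 0, 4 * M * L * τ < ρ → ∀ t, 0 ≤ t → t + τ ≤ T →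
    ∀ y, IsStrangStep A B b f τ (u t) y → ‖y - u (t + τ)‖ ≤ C * τ ^ 1 := by
  have hL := hb.one_le
  refine ⟨4 * M * L + 4 * M * L ^ 2 * T, fun τ hτ hρ t ht htτ y hy => ?_⟩
  have hτT : τ ≤ T := by linarith
  have h1 := hy.norm_sub_trapezoidalError_le hS hA hu hM1 hM hT hb hfu ht hτ.le htτ hρ
  have h2 := hS.norm_trapezoidalError_le (.id ℝ X) (y := f (u t)) hτ.le (c := 2 * M * L)
    fun r hr => by
      refine (norm_apply_sub_le_of_norm_le hM1 hM ⟨hr.1, hr.2.trans hτT⟩ _).trans ?_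
      gcongr
      exact (hb.local_bounds t ⟨ht, by linarith⟩).norm_le _ (Metric.mem_ball_self hb.pos)
  simp only [ContinuousLinearMap.id_apply] at h2
  have h3 := norm_le_norm_sub_add (y - u (t + τ)) (trapezoidalError S τ (f (u t)))
  have h4 : 4 * M * L ^ 2 * τ ^ 2 ≤ 4 * M * L ^ 2 * T * τ := by
    rw [sq τ, ← mul_assoc]; gcongr
  linarith

theorem exists_smoothed_defect_bound_order_one
    (hP : ParabolicSmoothing (dirichletRealization A B) S T) :
    ∃ C, ∀ τ > 0, 4 * M * L * τ < ρ → ∀ t, 0 ≤ t → t + τ ≤ T →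
    ∀ y, IsStrangStep A B b f τ (u t) y → ∀ s ∈ Ioc 0 T,
      ‖S s (y - u (t + τ))‖ ≤ C * τ ^ (1 + 1) * (1 + 1 / s) := by
  obtain ⟨K, hK0, hK⟩ := hP.exists_norm_le hS hA hM
  have hL := hb.one_le
  refine ⟨2 * K * M * L + 4 * M ^ 2 * L ^ 2, fun τ hτ hρ t ht htτ y hy s hs => ?_⟩
  have hτT : τ ≤ T := by linarith
  have hs0 := hs.1
  have h1 := hy.norm_sub_trapezoidalError_le hS hA hu hM1 hM hT hb hfu ht hτ.le htτ hρ
  have h2 := hS.norm_trapezoidalError_le (S s) (y := f (u t)) hτ.le (c := K / s * (M * L * τ))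
    fun r hr => by
      refine (hK s hs r ⟨hr.1, hr.2.trans hτT⟩ _).trans ?_
      have := hr.1
      gcongr
      · exact (hb.local_bounds t ⟨ht, by linarith⟩).norm_le _ (Metric.mem_ball_self hb.pos)
      · exact hr.2
  have h4 := ((S s).le_of_opNorm_le (hM s ⟨hs.1.le, hs.2⟩) _).trans
    (mul_le_mul_of_nonneg_left h1 (by linarith))
  rw [map_sub] at h4
  have h3 := norm_le_norm_sub_add (S s (y - u (t + τ))) (S s (trapezoidalError S τ (f (u t))))
  calc _ ≤ M * (4 * M * L ^ 2 * τ ^ 2) + 2 * (K / s * (M * L * τ)) * τ := by linarith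
    _ = (2 * K * M * L * (1 / s) + 4 * M ^ 2 * L ^ 2) * τ ^ 2 := by ring
    -- The added terms complete the product with 1 + 1 / s.
    _ ≤ (2 * K * M * L * (1 / s) + 4 * M ^ 2 * L ^ 2) * τ ^ 2
        + (2 * K * M * L + 4 * M ^ 2 * L ^ 2 * (1 / s)) * τ ^ 2 :=
      le_add_of_nonneg_right (by positivity)
    _ = _ := by ring

theorem IsStrangStep.norm_apply_defect_le {t τ : ℝ} (ht : 0 ≤ t) (hτ : 0 ≤ τ)
    (htτ : t + τ ≤ T) (hρ : 4 * M * L * τ < ρ) {κ : ℝ}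
    (hκ : ∀ r ∈ Icc 0 τ, ‖S r (f (u t)) - f (u t)‖ ≤ κ * τ)
    {y : X} (hy : IsStrangStep A B b f τ (u t) y) (P : X →L[ℝ] X) (hPM : ‖P‖ ≤ M) {c₁ c₂ : ℝ}
    (h₁ : ‖P (trapezoidalError S τ (f (u t)))‖ ≤ c₁)
    (hp : ∀ r ∈ Icc 0 τ, ‖P (S r (fderiv ℝ f (u t) (f (u t))) - fderiv ℝ f (u t) (f (u t)))‖ ≤ c₂)
    (hq : ∀ r ∈ Icc 0 τ, ‖P (S r (fderiv ℝ f (u t) (derivWithin u (Icc 0 T) t))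
      - fderiv ℝ f (u t) (derivWithin u (Icc 0 T) t))‖ ≤ c₂) :
    ‖P (y - u (t + τ))‖
      ≤ c₁ + 2 * c₂ * τ ^ 2 + M * ((20 * M ^ 2 * L ^ 3 + κ * L) * τ ^ 3) := by
  have hc₂ : 0 ≤ c₂ := (norm_nonneg _).trans (hp τ ⟨hτ, le_rfl⟩)
  have h := hy.norm_sub_trapezoidalError_sub_le hS hA hu hM1 hM hT hb hfu ht hτ htτ hρ hκ
  have h' := (P.le_of_opNorm_le hPM _).trans (mul_le_mul_of_nonneg_left h (by linarith))
  have h2 := hS.norm_integral_smul_apply_sub_le P hτ hq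
  have h3 := hp τ ⟨hτ, le_rfl⟩
  rw [map_sub] at h'
  refine (norm_le_norm_sub_add _ _).trans ((add_le_add h' ?_).trans_eq (add_comm _ _))
  rw [map_sub, map_add, map_smul]
  refine (_root_.norm_sub_le _ _).trans ((add_le_add ((norm_add_le _ _).trans
    (add_le_add h₁ ?_)) h2).trans (b := c₁ + τ ^ 2 / 8 * c₂ + c₂ * τ ^ 2) ?_)
  · rw [norm_smul, Real.norm_of_nonneg (by positivity)]
    gcongr
  · nlinarith [mul_nonneg hc₂ (sq_nonneg τ)]

section OrderTwo

variable {g : ℝ → X} (hg : ∀ t ∈ Icc 0 T, (f (u t), g t) ∈ (dirichletRealization A B).graph)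
  {K : ℝ} (hK : ∀ t ∈ Icc 0 T, ‖g t‖ ≤ K)
include hg hK

theorem exists_defect_bound_order_two :
    ∃ C, ∀ τ > 0, 4 * M * L * τ < ρ → ∀ t, 0 ≤ t → t + τ ≤ T →
    ∀ y, IsStrangStep A B b f τ (u t) y → ‖y - u (t + τ)‖ ≤ C * τ ^ 2 := by
  have hL := hb.one_le
  have hK0 : 0 ≤ K := (norm_nonneg _).trans (hK 0 ⟨le_rfl, hT.le⟩)
  refine ⟨2 * M * K + 4 * M * L ^ 2 + M * (20 * M ^ 2 * L ^ 3 + M * K * L) * T,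
    fun τ hτ hρ t ht htτ y hy => ?_⟩
  have htT : t ∈ Icc 0 T := ⟨ht, by linarith⟩
  have hτT : τ ≤ T := by linarith
  have hb' := hb.local_bounds t htT
  have hf := hb'.norm_le _ (Metric.mem_ball_self hb.pos)
  have hκ : ∀ r ∈ Icc 0 τ, ‖S r (f (u t)) - f (u t)‖ ≤ M * K * τ := fun r hr => by
    refine (hS.norm_apply_sub_le hA hM (hg t htT) ⟨hr.1, hr.2.trans hτT⟩).trans ?_
    have := hr.1
    gcongr
    · exact hK t htT
    · exact hr.2
  have hD : ∀ x : X, ‖x‖ ≤ L → ∀ r ∈ Icc 0 τ,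
      ‖S r (fderiv ℝ f (u t) x) - fderiv ℝ f (u t) x‖ ≤ 2 * M * L ^ 2 := fun x hx r hr => by
    refine (norm_apply_sub_le_of_norm_le hM1 hM ⟨hr.1, hr.2.trans hτT⟩ _).trans ?_
    gcongr
    rw [sq]
    refine ((fderiv ℝ f (u t)).le_of_opNorm_le hb'.norm_fderiv_le x).trans ?_
    gcongr
  have key := hy.norm_apply_defect_le hS hA hu hM1 hM hT hb hfu ht hτ.le htτ hρ hκ (.id ℝ X)
    (ContinuousLinearMap.norm_id_le.trans hM1)
    (hS.norm_trapezoidalError_le (.id ℝ X) hτ.le hκ) (hD _ hf) (hD _ (hb.norm_deriv_le t htT))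
  simp only [ContinuousLinearMap.id_apply] at key
  refine key.trans ?_
  have h4 : M * ((20 * M ^ 2 * L ^ 3 + M * K * L) * τ ^ 3)
      ≤ M * (20 * M ^ 2 * L ^ 3 + M * K * L) * T * τ ^ 2 := by
    calc _ = M * (20 * M ^ 2 * L ^ 3 + M * K * L) * τ * τ ^ 2 := by ring
      _ ≤ _ := by gcongr
  linarith

theorem exists_smoothed_defect_bound_order_two
    (hP : ParabolicSmoothing (dirichletRealization A B) S T) :
    ∃ C, ∀ τ > 0, 4 * M * L * τ < ρ → ∀ t, 0 ≤ t → t + τ ≤ T →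
    ∀ y, IsStrangStep A B b f τ (u t) y → ∀ s ∈ Ioc 0 T,
      ‖S s (y - u (t + τ))‖ ≤ C * τ ^ (2 + 1) * (1 + 1 / s) := by
  obtain ⟨N, hN0, hN⟩ := hP.exists_norm_le hS hA hM
  have hL := hb.one_le
  have hK0 : 0 ≤ K := (norm_nonneg _).trans (hK 0 ⟨le_rfl, hT.le⟩)
  refine ⟨2 * N * M * K + 2 * N * M * L ^ 2 + M * (20 * M ^ 2 * L ^ 3 + M * K * L),
    fun τ hτ hρ t ht htτ y hy s hs => ?_⟩
  have hs0 := hs.1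
  have htT : t ∈ Icc 0 T := ⟨ht, by linarith⟩
  have hτT : τ ≤ T := by linarith
  have hb' := hb.local_bounds t htT
  have hf := hb'.norm_le _ (Metric.mem_ball_self hb.pos)
  have hκ : ∀ r ∈ Icc 0 τ, ‖S r (f (u t)) - f (u t)‖ ≤ M * K * τ := fun r hr => by
    refine (hS.norm_apply_sub_le hA hM (hg t htT) ⟨hr.1, hr.2.trans hτT⟩).trans ?_
    have := hr.1
    gcongr
    · exact hK t htT
    · exact hr.2
  have hN' : ∀ x : X, ∀ a, ‖x‖ ≤ a → ∀ r ∈ Icc 0 τ, ‖S s (S r x - x)‖ ≤ N / s * (M * a * τ) := by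
    intro x a hx r hr
    refine (hN s hs r ⟨hr.1, hr.2.trans hτT⟩ x).trans ?_
    have := hr.1
    have := (norm_nonneg x).trans hx
    gcongr
    exact hr.2
  have hD : ∀ x : X, ‖x‖ ≤ L → ‖fderiv ℝ f (u t) x‖ ≤ L ^ 2 := fun x hx => by
    rw [sq]
    refine ((fderiv ℝ f (u t)).le_of_opNorm_le hb'.norm_fderiv_le x).trans ?_
    gcongr
  have key := hy.norm_apply_defect_le hS hA hu hM1 hM hT hb hfu ht hτ.le htτ hρ hκ (S s)
    (hM s ⟨hs.1.le, hs.2⟩)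
    (hS.norm_trapezoidalError_le_of_mem_graph hA (S s) hτ.le (hg t htT) (hN' _ _ (hK t htT)))
    (hN' _ _ (hD _ hf)) (hN' _ _ (hD _ (hb.norm_deriv_le t htT)))
  refine key.trans ?_
  calc _ = ((2 * N * M * K + 2 * N * M * L ^ 2) * (1 / s)
        + M * (20 * M ^ 2 * L ^ 3 + M * K * L)) * τ ^ 3 := by ring
    _ ≤ ((2 * N * M * K + 2 * N * M * L ^ 2) * (1 / s)
        + M * (20 * M ^ 2 * L ^ 3 + M * K * L)) * τ ^ 3
        + (2 * N * M * K + 2 * N * M * L ^ 2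
        + M * (20 * M ^ 2 * L ^ 3 + M * K * L) * (1 / s)) * τ ^ 3 :=
      le_add_of_nonneg_right (by positivity)
    _ = _ := by ring

end OrderTwo

/-- The trapezoidal error is cubic because A₀ f (u t) lies in the domain of `A₀`. For the other two
terms only Lipschitz orbits are needed, which the difference quotients of f ∘ u and of s ↦ f (u t +
s • f (u t)) provide. -/
theorem exists_defect_bound_order_three (hu' : DifferentiableOn ℝ u (Icc 0 T))
    (hf : ∀ t ∈ Icc 0 T, DifferentiableAt ℝ f (u t))
    (hf₀ : ReactionVanishesOnBoundary A B b f) (hf₁ : VerySmoothReaction A f T u)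
    (hf₂ : ∀ t ∈ Icc 0 T, ∀ y, (f (u t), y) ∈ A.graph → ∀ h : y ∈ A.domain, B ⟨y, h⟩ = 0) :
    ∃ C, ∀ τ > 0, 4 * M * L * τ < ρ → ∀ t, 0 ≤ t → t + τ ≤ T →
    ∀ y, IsStrangStep A B b f τ (u t) y → ‖y - u (t + τ)‖ ≤ C * τ ^ 3 := by
  have hL := hb.one_le
  obtain ⟨σ, G, g, hσ, hG, hfG, hg, hGg⟩ := hf₁
  obtain ⟨N, hN⟩ := hG.exists_lipschitzOnWith one_ne_zero ((convex_Icc 0 T).prod (convex_Icc 0 σ))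
    (isCompact_Icc.prod isCompact_Icc)
  obtain ⟨K₀, hK₀⟩ := (isCompact_Icc.prod isCompact_Icc).exists_bound_of_continuousOn hG.continuousOn
  obtain ⟨K₁, hK₁⟩ := isCompact_Icc.exists_bound_of_continuousOn hg
  have hN0 : (0 : ℝ) ≤ N := N.2
  have hσ0 : (0 : ℝ) ∈ Icc 0 σ := ⟨le_rfl, hσ.le⟩
  have hfG' : ∀ t ∈ Icc 0 T, (f (u t), G (t, 0)) ∈ (dirichletRealization A B).graph := by
    intro t ht
    refine hf₀.mem_graph (hu.hasImageAndBoundaryValue hT ht) ?_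
    simpa using hfG t ht 0 hσ0
  have hGg' : ∀ t ∈ Icc 0 T, (G (t, 0), g t) ∈ (dirichletRealization A B).graph := by
    intro t ht
    obtain ⟨w, hw, hw'⟩ := (LinearPMap.mem_graph_iff _).1 (hGg t ht)
    simp only at hw hw'
    have hwd : G (t, 0) ∈ A.domain := hw ▸ w.2
    refine mem_graph_dirichletRealization_iff.2
      ⟨hwd, hf₂ t ht _ (by simpa using hfG t ht 0 hσ0) hwd, ?_⟩
    rw [← hw']
    congr 1
    exact Subtype.ext hw.symm
  -- Since f (u t) vanishes on the boundary, u t + s • f (u t) still has boundary value b, so f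
  -- vanishes there too.
  have hfG'' : ∀ t ∈ Icc 0 T, ∀ s ∈ Icc 0 σ,
      (f (u t + s • f (u t)), G (t, s)) ∈ (dirichletRealization A B).graph := by
    intro t ht s hs
    have h1 := (hu.hasImageAndBoundaryValue hT ht).add
      ((mem_graph_dirichletRealization_iff.1 (hfG' t ht)).smul s)
    rw [smul_zero, add_zero] at h1
    exact hf₀.mem_graph h1 (hfG t ht s hs)
  refine ⟨2 * M * K₁ + 2 * M * N + M * (20 * M ^ 2 * L ^ 3 + M * K₀ * L),
    fun τ hτ hρ t ht htτ y hy => ?_⟩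
  have htT : t ∈ Icc 0 T := ⟨ht, by linarith⟩
  have hτT : τ ≤ T := by linarith
  have hM0 : 0 ≤ M := by linarith
  have hrT : ∀ {r}, r ∈ Icc 0 τ → r ∈ Icc 0 T := fun hr => ⟨hr.1, hr.2.trans hτT⟩
  have hκ : ∀ {x y : X} {k : ℝ}, (x, y) ∈ (dirichletRealization A B).graph → ‖y‖ ≤ k →
      ∀ r ∈ Icc 0 τ, ‖S r x - x‖ ≤ M * k * τ := fun hxy hk r hr => by
    refine (hS.norm_apply_sub_le hA hM hxy (hrT hr)).trans ?_
    have := hr.1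
    have := (norm_nonneg _).trans hk
    gcongr
    exact hr.2
  -- The derivative of f in direction f (u t) is a limit of quotients in the domain of `A₀`, whose
  -- images are difference quotients of G in s, bounded by its Lipschitz constant N.
  have hp : ∀ r ∈ Icc 0 τ, ‖S r (fderiv ℝ f (u t) (f (u t))) - fderiv ℝ f (u t) (f (u t))‖
      ≤ M * N * τ := by
    intro r hr
    have hd : HasDerivAt (fun s : ℝ => f (u t + s • f (u t))) (fderiv ℝ f (u t) (f (u t))) 0 := by
      have h1 : HasDerivAt (fun s : ℝ => u t + s • f (u t)) (f (u t)) 0 := by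
        simpa using ((hasDerivAt_id (0 : ℝ)).smul_const (f (u t))).const_add (u t)
      have h2 : HasFDerivAt f (fderiv ℝ f (u t)) (u t + (0 : ℝ) • f (u t)) := by
        simpa using (hf t htT).hasFDerivAt
      exact h2.comp_hasDerivAt (0 : ℝ) h1
    refine (hS.norm_apply_sub_le_of_tendsto hA hM hd.tendsto_slope_zero_right
      (y := fun s => s⁻¹ • (G (t, s) - G (t, 0))) (K := N) hM0 ?_ (hrT hr)).trans
      (by gcongr; exact hr.2)
    filter_upwards [Ioc_mem_nhdsGT hσ] with s hs
    have hs' : s ∈ Icc 0 σ := Ioc_subset_Icc_self hs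
    refine ⟨?_, ?_⟩
    · simp only [zero_add, zero_smul, add_zero]
      exact Submodule.smul_mem _ _ (Submodule.sub_mem _ (hfG'' t htT s hs') (hfG' t htT))
    · have h1 := hN.norm_sub_le (mk_mem_prod htT hs') (mk_mem_prod htT hσ0)
      rw [norm_smul, norm_inv, Real.norm_of_nonneg hs.1.le, inv_mul_le_iff₀ hs.1, mul_comm]
      simpa [Prod.norm_def, abs_of_pos hs.1, hs.1.le] using h1
  have hq : ∀ r ∈ Icc 0 τ, ‖S r (fderiv ℝ f (u t) (derivWithin u (Icc 0 T) t))
      - fderiv ℝ f (u t) (derivWithin u (Icc 0 T) t)‖ ≤ M * N * τ := by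
    intro r hr
    -- As t < T, the derivative of f ∘ u at t is a limit of slopes from the right, including at t =
    -- 0.
    have htlt : t < T := by linarith
    have hd : HasDerivWithinAt (fun s => f (u s))
        (fderiv ℝ f (u t) (derivWithin u (Icc 0 T) t)) (Ioi t) t :=
      ((hf t htT).hasFDerivAt.comp_hasDerivWithinAt t
        (hu' t htT).hasDerivWithinAt).mono_of_mem_nhdsWithin
        (mem_of_superset (Ioc_mem_nhdsGT htlt) fun s hs => ⟨ht.trans hs.1.le, hs.2⟩)
    rw [hasDerivWithinAt_iff_tendsto_slope' (by simp)] at hd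
    refine (hS.norm_apply_sub_le_of_tendsto hA hM hd
      (y := fun s => (s - t)⁻¹ • (G (s, 0) - G (t, 0))) (K := N) hM0 ?_ (hrT hr)).trans
      (by gcongr; exact hr.2)
    filter_upwards [Ioc_mem_nhdsGT htlt] with s hs
    have hs' : s ∈ Icc 0 T := ⟨ht.trans hs.1.le, hs.2⟩
    have hst : 0 < s - t := sub_pos.2 hs.1
    refine ⟨?_, ?_⟩
    · rw [slope_def_module]
      exact Submodule.smul_mem _ _ (Submodule.sub_mem _ (hfG' s hs') (hfG' t htT))
    · have h1 := hN.norm_sub_le (mk_mem_prod hs' hσ0) (mk_mem_prod htT hσ0)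
      rw [norm_smul, norm_inv, Real.norm_of_nonneg hst.le, inv_mul_le_iff₀ hst, mul_comm]
      simpa [Prod.norm_def, abs_of_pos hst, hst.le] using h1
  have key := hy.norm_apply_defect_le hS hA hu hM1 hM hT hb hfu ht hτ.le htτ hρ
    (hκ (hfG' t htT) (hK₀ (t, 0) ⟨htT, hσ0⟩)) (.id ℝ X)
    (ContinuousLinearMap.norm_id_le.trans hM1)
    (hS.norm_trapezoidalError_le_of_mem_graph hA (.id ℝ X) hτ.le (hfG' t htT)
      (hκ (hGg' t htT) (hK₁ t htT))) hp hq
  simp only [ContinuousLinearMap.id_apply] at key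
  refine key.trans (le_of_eq ?_)
  ring

end DefectBounds

/-! ### From defects to the global error -/

section GlobalErrorBounds

variable {X Y : Type*} [NormedAddCommGroup X] [NormedSpace ℝ X] [AddCommGroup Y] [Module ℝ Y]

theorem le_mul_one_add_pow_of_le_add_sum {e : ℕ → ℝ} {a D : ℝ} (ha : 0 ≤ a) {n : ℕ}
    (h : ∀ m ≤ n, e m ≤ D + a * ∑ k ∈ Finset.range m, e k) : ∀ m ≤ n, e m ≤ D * (1 + a) ^ m := by
  intro m
  induction m using Nat.strong_induction_on with
  | _ m ih =>
    intro hm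
    have h1 : ∑ k ∈ Finset.range m, e k ≤ ∑ k ∈ Finset.range m, D * (1 + a) ^ k :=
      Finset.sum_le_sum fun k hk => ih k (Finset.mem_range.1 hk)
        ((Finset.mem_range.1 hk).le.trans hm)
    have h2 := mul_geom_sum (1 + a) m
    rw [add_sub_cancel_left] at h2
    calc e m ≤ D + a * ∑ k ∈ Finset.range m, D * (1 + a) ^ k := (h m hm).trans (by gcongr)
      _ = D + D * (a * ∑ k ∈ Finset.range m, (1 + a) ^ k) := by rw [← Finset.mul_sum]; ring
      _ = D * (1 + a) ^ m := by rw [h2]; ring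

theorem sum_range_inv_sub_le {m : ℕ} {τ T : ℝ} (hτ : 0 < τ) (hm : m * τ ≤ T) :
    ∑ k ∈ Finset.range m, (1 : ℝ) / (m - k) ≤ 1 + |Real.log T| + |Real.log τ| := by
  rcases Nat.eq_zero_or_pos m with rfl | hm0
  · simp only [Finset.range_zero, Finset.sum_empty]
    positivity
  have hm0' : (0 : ℝ) < m := by exact_mod_cast hm0
  have h1 : ∑ k ∈ Finset.range m, (1 : ℝ) / (m - k) = (harmonic m : ℝ) := by
    rw [← Finset.sum_range_reflect, harmonic]
    push_cast
    refine Finset.sum_congr rfl fun k hk => ?_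
    have hk := Finset.mem_range.1 hk
    rw [Nat.cast_sub (by omega), Nat.cast_sub (by omega), one_div]
    push_cast
    congr 1
    ring
  have hT : 0 < T := lt_of_lt_of_le (by positivity) hm
  have h2 : Real.log m ≤ Real.log T - Real.log τ := by
    rw [← Real.log_div hT.ne' hτ.ne']
    exact Real.log_le_log hm0' ((le_div_iff₀ hτ).2 hm)
  rw [h1]
  linarith [harmonic_le_one_add_log m, le_abs_self (Real.log T), neg_abs_le (Real.log τ)]

theorem tendsto_mul_one_add_abs_log :
    Tendsto (fun τ : ℝ => τ * (1 + |Real.log τ|)) (𝓝[>] 0) (𝓝 0) := by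
  have h : Continuous fun τ : ℝ => τ + |Real.log τ * τ| := by
    have := Real.continuous_mul_log
    simp only [mul_comm (Real.log _)]
    fun_prop
  have h' : Tendsto (fun τ : ℝ => τ + |Real.log τ * τ|) (𝓝[>] 0) (𝓝 0) := by
    simpa using (h.tendsto 0).mono_left nhdsWithin_le_nhds
  refine h'.congr' ?_
  filter_upwards [self_mem_nhdsWithin] with τ hτ
  rw [abs_mul, abs_of_pos (show 0 < τ from hτ)]
  ring

variable {S : ℝ → X →L[ℝ] X} {T M : ℝ} (hM : ∀ t ∈ Icc 0 T, ‖S t‖ ≤ M)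
include hM

/-- Discrete variation of constants writes e m as the sum of the propagated d k plus perturbations,
so each power of S is one semigroup operator of norm at most M; the discrete Gronwall inequality
absorbs the perturbations. -/
theorem IsC0Semigroup.norm_le_of_recursion (hS : IsC0Semigroup S) {τ c D : ℝ} (hτ : 0 ≤ τ)
    (hc : 0 ≤ c) (hM0 : 0 ≤ M)
    {n : ℕ} (hn : n * τ ≤ T) {e d : ℕ → X} (he₀ : e 0 = 0)
    (he : ∀ k < n, ‖e (k + 1) - S τ (e k) - d k‖ ≤ c * τ * ‖e k‖)
    (hd : ∀ m ≤ n, ‖∑ k ∈ Finset.range m, S (((m : ℝ) - 1 - k) * τ) (d k)‖ ≤ D) :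
    ‖e n‖ ≤ D * Real.exp (M * c * T) := by
  have hD : 0 ≤ D := (norm_nonneg _).trans (hd n le_rfl)
  have rep : ∀ m ≤ n, e m = ∑ k ∈ Finset.range m,
      S (((m : ℝ) - 1 - k) * τ) (d k + (e (k + 1) - S τ (e k) - d k)) := by
    intro m
    induction m with
    | zero => intro _; simpa using he₀
    | succ m ih =>
      intro hm
      rw [Finset.sum_range_succ]
      have h1 : ∑ k ∈ Finset.range m, S ((((m + 1 : ℕ) : ℝ) - 1 - k) * τ)
          (d k + (e (k + 1) - S τ (e k) - d k)) = S τ (e m) := by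
        conv_rhs => rw [ih (by omega), map_sum]
        refine Finset.sum_congr rfl fun k hk => ?_
        have hk : (k : ℝ) + 1 ≤ m := by exact_mod_cast Finset.mem_range.1 hk
        rw [← hS.add _ _ hτ (mul_nonneg (by linarith) hτ)]
        congr 2
        push_cast
        ring
      rw [h1]
      have h2 : (((m + 1 : ℕ) : ℝ) - 1 - m) * τ = 0 := by push_cast; ring
      rw [h2, hS.zero]
      abel
  have h1 : ∀ m ≤ n, ‖e m‖ ≤ D + M * c * τ * ∑ k ∈ Finset.range m, ‖e k‖ := by
    intro m hm
    rw [rep m hm]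
    simp only [map_add (S _), Finset.sum_add_distrib]
    refine (norm_add_le _ _).trans (add_le_add (hd m hm) ?_)
    rw [Finset.mul_sum]
    refine (norm_sum_le _ _).trans (Finset.sum_le_sum fun k hk => ?_)
    have hk := Finset.mem_range.1 hk
    have hk' : (k : ℝ) + 1 ≤ m := by exact_mod_cast hk
    have hm' : (m : ℝ) ≤ n := by exact_mod_cast hm
    have hmem : ((m : ℝ) - 1 - k) * τ ∈ Icc 0 T := by
      refine ⟨mul_nonneg (by linarith) hτ, le_trans ?_ hn⟩
      gcongr
      linarith [(Nat.cast_nonneg k : (0 : ℝ) ≤ k)]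
    refine ((S _).le_of_opNorm_le (hM _ hmem) _).trans ?_
    calc _ ≤ M * (c * τ * ‖e k‖) := by gcongr; exact he k (by omega)
      _ = _ := by ring
  refine (le_mul_one_add_pow_of_le_add_sum (by positivity) h1 n le_rfl).trans ?_
  gcongr
  calc (1 + M * c * τ) ^ n ≤ Real.exp (M * c * τ) ^ n := by
        gcongr
        linarith [Real.add_one_le_exp (M * c * τ)]
    _ = Real.exp (M * c * (n * τ)) := by rw [← Real.exp_nat_mul]; congr 1; ring
    _ ≤ _ := by gcongr

theorem norm_sum_apply_le_of_smoothing (hM1 : 1 ≤ M) {τ C : ℝ} (hτ : 0 < τ) {p n : ℕ}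
    (hn : n * τ ≤ T) {d : ℕ → X} (hd : ∀ k < n, ‖d k‖ ≤ C * τ ^ p)
    (hd' : ∀ k < n, ∀ s ∈ Ioc 0 T, ‖S s (d k)‖ ≤ C * τ ^ (p + 1) * (1 + 1 / s)) (hC : 0 ≤ C) :
    ‖∑ k ∈ Finset.range n, S (((n : ℝ) - 1 - k) * τ) (d k)‖
      ≤ C * (M + T + 1 + |Real.log T|) * (τ ^ p * (1 + |Real.log τ|)) := by
  have hT : 0 ≤ T := le_trans (by positivity) hn
  -- With n = m + 1 the terms k < m are smoothed over the time (m - k) τ, which turns τ ^ (p + 1) /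
  -- s into τ ^ p / (m - k), a harmonic sum. The term k = m carries S 0 and uses the unsmoothed
  -- bound.
  rcases n with _ | m
  · simp only [Finset.range_zero, Finset.sum_empty, norm_zero]
    positivity
  push_cast at hn ⊢
  have hmT : m * τ ≤ T := by linarith
  have h0 : (0 : ℝ) ∈ Icc 0 T := ⟨le_rfl, hT⟩
  have h1 : ‖∑ k ∈ Finset.range m, S (((m : ℝ) + 1 - 1 - k) * τ) (d k)‖
      ≤ C * τ ^ p * (m * τ + ∑ k ∈ Finset.range m, (1 : ℝ) / (m - k)) := by
    have e : (m : ℝ) * τ + ∑ k ∈ Finset.range m, (1 : ℝ) / (m - k)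
        = ∑ k ∈ Finset.range m, (τ + 1 / ((m : ℝ) - k)) := by
      rw [Finset.sum_add_distrib]
      simp
    rw [e, Finset.mul_sum]
    refine (norm_sum_le _ _).trans (Finset.sum_le_sum fun k hk => ?_)
    have hk := Finset.mem_range.1 hk
    have hk' : (0 : ℝ) < m - k := sub_pos.2 (by exact_mod_cast hk)
    rw [add_sub_cancel_right]
    refine (hd' k (by omega) _ ⟨by positivity, le_trans ?_ hmT⟩).trans_eq ?_
    · gcongr
      linarith [(Nat.cast_nonneg k : (0 : ℝ) ≤ k)]
    · field_simp
      ring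
  rw [Finset.sum_range_succ]
  have h2 : ‖S (((m : ℝ) + 1 - 1 - m) * τ) (d m)‖ ≤ M * (C * τ ^ p) := by
    have e : ((m : ℝ) + 1 - 1 - m) * τ = 0 := by ring
    rw [e]
    refine ((S 0).le_of_opNorm_le (hM 0 h0) _).trans ?_
    gcongr
    exact hd m (by omega)
  have h3 := sum_range_inv_sub_le hτ hmT
  have hl := abs_nonneg (Real.log τ)
  have hl' := abs_nonneg (Real.log T)
  calc _ ≤ C * τ ^ p * (T + (1 + |Real.log T| + |Real.log τ|)) + M * (C * τ ^ p) :=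
        (norm_add_le _ _).trans (add_le_add (h1.trans (by gcongr)) h2)
    _ = C * τ ^ p * (M + T + 1 + |Real.log T| + 1 * |Real.log τ|) := by ring
    _ ≤ C * τ ^ p * (M + T + 1 + |Real.log T| + (M + T + 1 + |Real.log T|) * |Real.log τ|) := by
      gcongr
      linarith
    _ = _ := by ring

theorem norm_sum_apply_le {τ C : ℝ} (hτ : 0 < τ) (hM0 : 0 ≤ M) {p n : ℕ}
    (hn : n * τ ≤ T) {d : ℕ → X} (hd : ∀ k < n, ‖d k‖ ≤ C * τ ^ (p + 1)) (hC : 0 ≤ C) :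
    ‖∑ k ∈ Finset.range n, S (((n : ℝ) - 1 - k) * τ) (d k)‖ ≤ M * C * T * τ ^ p := by
  have h1 : ∀ k ∈ Finset.range n, ‖S (((n : ℝ) - 1 - k) * τ) (d k)‖ ≤ M * (C * τ ^ (p + 1)) := by
    intro k hk
    have hk := Finset.mem_range.1 hk
    have hk' : (k : ℝ) + 1 ≤ n := by exact_mod_cast hk
    refine ((S _).le_of_opNorm_le (hM _ ⟨mul_nonneg (by linarith) hτ.le, le_trans ?_ hn⟩) _).trans ?_
    · gcongr
      linarith [(Nat.cast_nonneg k : (0 : ℝ) ≤ k)]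
    · gcongr
      exact hd k hk
  refine (norm_sum_le_of_le _ h1).trans ?_
  rw [Finset.sum_const, Finset.card_range, nsmul_eq_mul]
  calc _ = M * C * (n * τ) * τ ^ p := by ring
    _ ≤ _ := by gcongr

variable [CompleteSpace X] (hS : IsContinuousSemigroup S)
  {A : X →ₗ.[ℝ] X} {B : A.domain →ₗ[ℝ] Y} {b : Y} {f : X → X}
  (hA : IsGenerator (dirichletRealization A B) S) {u : ℝ → X}
  (hu : IsExactSolution A B b f T u) {ρ L : ℝ} (hM1 : 1 ≤ M)
  (hT : 0 < T) (hb : TrajectoryBounds f u T ρ L)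
include hS hA hu hM1 hT hb

theorem localError_of_defect_bound {r : ℝ → ℝ} {C : ℝ}
    (h : ∀ τ > 0, 4 * M * L * τ < ρ → ∀ t, 0 ≤ t → t + τ ≤ T →
      ∀ y, IsStrangStep A B b f τ (u t) y → ‖y - u (t + τ)‖ ≤ C * r τ) :
    LocalError A B b f T u r := by
  have hL := hb.one_le
  have hρ := hb.pos
  refine ⟨C, ρ / (8 * M * L), by positivity, fun τ hτ t ht htτ => ?_⟩
  have hτρ : 4 * M * L * τ < ρ := by
    have := (le_div_iff₀ (by positivity)).1 hτ.2
    linarith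
  refine ⟨?_, h τ hτ.1 hτρ t ht htτ⟩
  have hτ0 := hτ.1
  exact exists_isStrangStep hS hA hu hM1 hM hT hb (t := t) ⟨ht, by linarith⟩
    ⟨hτ0.le, by linarith⟩ (by simpa using hτρ)

/-- Stability holds only near the trajectory. Since r τ → 0, the error bound itself keeps the
approximations in that region for small τ; existence of the steps and the bound are then propagated
by induction. -/
theorem globalError_of_sum_defect_bound {r : ℝ → ℝ} (hr : Tendsto r (𝓝[>] 0) (𝓝 0)) {C : ℝ}
    (h : ∀ τ > 0, 4 * M * L * τ < ρ → ∀ n : ℕ, n * τ ≤ T → ∀ y : ℕ → X,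
      (∀ k < n, IsStrangStep A B b f τ (u (k * τ)) (y k)) →
      ‖∑ k ∈ Finset.range n, S (((n : ℝ) - 1 - k) * τ) (y k - u ((k + 1 : ℕ) * τ))‖ ≤ C * r τ) :
    GlobalError A B b f T u r := by
  have hL := hb.one_le
  have hρ := hb.pos
  set E := Real.exp (M * (6 * M * L) * T)
  have hlim : Tendsto (fun τ => M * (C * r τ * E) + 4 * M * L * τ) (𝓝[>] 0) (𝓝 0) := by
    have h1 : Tendsto (fun τ : ℝ => 4 * M * L * τ) (𝓝[>] 0) (𝓝 0) := by
      have : Continuous fun τ : ℝ => 4 * M * L * τ := by fun_prop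
      simpa using (this.tendsto 0).mono_left nhdsWithin_le_nhds
    simpa using (((hr.const_mul C).mul_const E).const_mul M).add h1
  -- For τ < ε an approximation satisfying the error bound meets the smallness condition for a
  -- further step.
  obtain ⟨ε, hε, hsmall⟩ := (nhdsGT_basis (0 : ℝ)).eventually_iff.1 (hlim.eventually_lt_const hρ)
  refine ⟨C * E, min (ε / 2) (min (ρ / (8 * M * L)) (1 / L)), by positivity, fun τ hτ => ?_⟩
  have hτ0 := hτ.1
  have hs := hsmall ⟨hτ0, lt_of_le_of_lt (hτ.2.trans (min_le_left _ _)) (half_lt_self hε)⟩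
  have hτρ : 4 * M * L * τ < ρ := by
    have := (le_div_iff₀ (by positivity)).1
      ((hτ.2.trans (min_le_right _ _)).trans (min_le_left _ _))
    linarith
  have hLτ : L * τ ≤ 1 := by
    have := (le_div_iff₀ (by positivity)).1
      ((hτ.2.trans (min_le_right _ _)).trans (min_le_right _ _))
    linarith
  have hmem : ∀ {k n : ℕ}, n * τ ≤ T → k ≤ n → (k : ℝ) * τ ∈ Icc 0 T := fun {k n} hn hk => by
    have : (k : ℝ) ≤ n := by exact_mod_cast hk
    exact ⟨by positivity, le_trans (by gcongr) hn⟩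
  have hτT : ∀ {n : ℕ}, n * τ ≤ T → 0 < n → τ ∈ Icc 0 T := fun hn h0 => by
    simpa using hmem hn h0
  have key : ∀ n : ℕ, n * τ ≤ T → ∀ U, IsStrangSequence A B b f τ (u 0) n U →
      ‖U n - u (n * τ)‖ ≤ C * r τ * E := by
    intro n
    induction n using Nat.strong_induction_on with
    | _ n ih =>
      intro hn U hU
      have hx : ∀ k < n, M * ‖U k - u (k * τ)‖ + 4 * M * L * τ < ρ := fun k hk => by
        have h1 := ih k hk (hmem hn hk.le).2 U ⟨hU.1, fun j hj => hU.2 j (hj.trans hk)⟩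
        have : M * ‖U k - u (k * τ)‖ ≤ M * (C * r τ * E) := by gcongr
        linarith
      -- One Strang step from the exact solution at each grid time defines the defects; the value 0
      -- for k ≥ n is never used.
      have hex : ∀ k, ∃ y, k < n → IsStrangStep A B b f τ (u (k * τ)) y := fun k => by
        by_cases hk : k < n
        · obtain ⟨y, hy⟩ := exists_isStrangStep hS hA hu hM1 hM hT hb (x₀ := u (k * τ))
            (hmem hn hk.le) (hτT hn (by omega)) (by simpa using hτρ)
          exact ⟨y, fun _ => hy⟩
        · exact ⟨0, fun h => absurd h hk⟩
      choose y hy using hex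
      refine hS.norm_le_of_recursion hM (c := 6 * M * L) hτ0.le (by positivity) (by linarith) hn
        (e := fun k => U k - u (k * τ)) (d := fun k => y k - u ((k + 1 : ℕ) * τ))
        (by simp [hU.1]) (fun k hk => ?_) (fun m hm => ?_)
      · have h1 := (hU.2 k hk).norm_sub_sub_le hS hA hu hM1 hM hT hb (hmem hn hk.le)
          (hτT hn (by omega)) hLτ (hx k hk) (by simpa using hτρ) (hy k hk)
        refine le_trans (le_of_eq ?_) h1
        congr 1
        abel
      · exact h τ hτ0 hτρ m (hmem hn hm).2 y fun k hk => hy k (hk.trans_le hm)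
  intro n hn
  refine ⟨?_, fun U hU => (key n hn U hU).trans_eq (by ring)⟩
  induction n with
  | zero => exact ⟨fun _ => u 0, rfl, fun k hk => absurd hk (Nat.not_lt_zero k)⟩
  | succ n ih =>
    have hn' := (hmem hn n.le_succ).2
    obtain ⟨U, hU⟩ := ih hn'
    have h1 : M * ‖U n - u (n * τ)‖ ≤ M * (C * r τ * E) := by
      gcongr
      exact key n hn' U hU
    obtain ⟨y, hy⟩ := exists_isStrangStep hS hA hu hM1 hM hT hb (x₀ := U n)
      (hmem hn n.le_succ) (hτT hn n.succ_pos) (by linarith)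
    refine ⟨Function.update U (n + 1) y, ?_, fun k hk => ?_⟩
    · rw [Function.update_of_ne (by omega)]
      exact hU.1
    · rw [Function.update_of_ne (by omega)]
      rcases Nat.lt_succ_iff_lt_or_eq.1 hk with hk | rfl
      · rw [Function.update_of_ne (by omega)]
        exact hU.2 k hk
      · rwa [Function.update_self]

theorem globalError_of_smoothed_defect_bound {p : ℕ} (hp : p ≠ 0) {C C' : ℝ}
    (h : ∀ τ > 0, 4 * M * L * τ < ρ → ∀ t, 0 ≤ t → t + τ ≤ T →
      ∀ y, IsStrangStep A B b f τ (u t) y → ‖y - u (t + τ)‖ ≤ C * τ ^ p)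
    (h' : ∀ τ > 0, 4 * M * L * τ < ρ → ∀ t, 0 ≤ t → t + τ ≤ T →
      ∀ y, IsStrangStep A B b f τ (u t) y → ∀ s ∈ Ioc 0 T,
        ‖S s (y - u (t + τ))‖ ≤ C' * τ ^ (p + 1) * (1 + 1 / s)) :
    GlobalError A B b f T u fun τ => τ ^ p * (1 + |Real.log τ|) := by
  have hr : Tendsto (fun τ : ℝ => τ ^ p * (1 + |Real.log τ|)) (𝓝[>] 0) (𝓝 0) := by
    obtain ⟨q, rfl⟩ := Nat.exists_eq_succ_of_ne_zero hp
    have h1 : Tendsto (fun τ : ℝ => τ ^ q) (𝓝[>] 0) (𝓝 (0 ^ q)) :=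
      ((continuous_pow q).tendsto 0).mono_left nhdsWithin_le_nhds
    have := h1.mul tendsto_mul_one_add_abs_log
    rw [mul_zero] at this
    refine this.congr fun τ => ?_
    rw [pow_succ]
    ring
  refine globalError_of_sum_defect_bound hM hS hA hu hM1 hT hb hr
    (C := max 0 (max C C') * (M + T + 1 + |Real.log T|)) fun τ hτ hρ n hn y hy => ?_
  have hkT : ∀ k < n, (k : ℝ) * τ + τ ≤ T := fun k hk => by
    have : (k : ℝ) + 1 ≤ n := by exact_mod_cast hk
    nlinarith
  have e : ∀ k : ℕ, ((k + 1 : ℕ) : ℝ) * τ = k * τ + τ := fun k => by push_cast; ring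
  refine norm_sum_apply_le_of_smoothing hM hM1 (C := max 0 (max C C')) hτ hn (fun k hk => ?_)
    (fun k hk s hs => ?_) (le_max_left _ _)
  · rw [e]
    refine (h τ hτ hρ _ (by positivity) (hkT k hk) _ (hy k hk)).trans ?_
    gcongr
    exact (le_max_left _ _).trans (le_max_right _ _)
  · rw [e]
    refine (h' τ hτ hρ _ (by positivity) (hkT k hk) _ (hy k hk) s hs).trans ?_
    have := hs.1
    gcongr
    exact (le_max_right _ _).trans (le_max_right _ _)

theorem globalError_of_defect_bound {p : ℕ} (hp : p ≠ 0) {C : ℝ}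
    (h : ∀ τ > 0, 4 * M * L * τ < ρ → ∀ t, 0 ≤ t → t + τ ≤ T →
      ∀ y, IsStrangStep A B b f τ (u t) y → ‖y - u (t + τ)‖ ≤ C * τ ^ (p + 1)) :
    GlobalError A B b f T u fun τ => τ ^ p := by
  have hr : Tendsto (fun τ : ℝ => τ ^ p) (𝓝[>] 0) (𝓝 0) := by
    have := ((continuous_pow p).tendsto (0 : ℝ)).mono_left (nhdsWithin_le_nhds (s := Ioi 0))
    rwa [zero_pow hp] at this
  refine globalError_of_sum_defect_bound hM hS hA hu hM1 hT hb hr (C := M * max 0 C * T)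
    fun τ hτ hρ n hn y hy => ?_
  refine norm_sum_apply_le hM (C := max 0 C) hτ (by linarith) hn (fun k hk => ?_)
    (le_max_left _ _)
  have hk' : (k : ℝ) + 1 ≤ n := by exact_mod_cast hk
  have e : ((k + 1 : ℕ) : ℝ) * τ = k * τ + τ := by push_cast; ring
  rw [e]
  refine (h τ hτ hρ _ (by positivity) (by nlinarith) _ (hy k hk)).trans ?_
  gcongr
  exact le_max_right _ _

end GlobalErrorBounds

end StrangBoundary

/-! ### The three cases -/

theorem mainTheorem3 {X Y : Type*} [NormedAddCommGroup X] [NormedSpace ℝ X] [CompleteSpace X]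
    [AddCommGroup Y] [Module ℝ Y]
    (A : X →ₗ.[ℝ] X) (B : A.domain →ₗ[ℝ] Y) (b : Y) (f : X → X)
    (S : ℝ → X →L[ℝ] X) (hS : StrangBoundary.IsC0Semigroup S)
    (hA₀ : StrangBoundary.IsGenerator (StrangBoundary.dirichletRealization A B) S)
    (T : ℝ) (hT : 0 < T) (u : ℝ → X)
    (hu : StrangBoundary.IsExactSolution A B b f T u)
    (hu_smooth : ContDiffOn ℝ 3 u (Icc 0 T))
    (hf_smooth : ∀ t ∈ Icc 0 T, ContDiffAt ℝ 2 f (u t)) :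
    -- any reaction: order one
    (StrangBoundary.LocalError A B b f T u (fun τ => τ) ∧
      (StrangBoundary.ParabolicSmoothing (StrangBoundary.dirichletRealization A B) S T →
        StrangBoundary.GlobalError A B b f T u (fun τ => τ * (1 + |Real.log τ|)))) ∧
    -- the reaction leaves the boundary data invariant
    (StrangBoundary.ReactionVanishesOnBoundary A B b f →
      StrangBoundary.SmoothReaction A f T u →
      StrangBoundary.LocalError A B b f T u (fun τ => τ ^ 2) ∧
      (StrangBoundary.ParabolicSmoothing (StrangBoundary.dirichletRealization A B) S T →
        StrangBoundary.GlobalError A B b f T u (fun τ => τ ^ 2 * (1 + |Real.log τ|)))) ∧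
    -- in addition `A f(u)` vanishes on the boundary; no parabolic smoothing is needed
    (StrangBoundary.ReactionVanishesOnBoundary A B b f →
      StrangBoundary.VerySmoothReaction A f T u →
      (∀ t ∈ Icc 0 T, ∀ y, (f (u t), y) ∈ A.graph → ∀ h : y ∈ A.domain, B ⟨y, h⟩ = 0) →
      StrangBoundary.LocalError A B b f T u (fun τ => τ ^ 3) ∧
      StrangBoundary.GlobalError A B b f T u (fun τ => τ ^ 2)) := by
  -- Freezing the semigroup at negative times makes its orbits continuous on ℝ and changes neither
  -- the generator nor the smoothing property, which only see t > 0.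
  have hS' := hS.isContinuousSemigroup_comp_max
  have hA' := hA₀.comp_max
  obtain ⟨M, hM1, hM⟩ := hS'.exists_norm_le T
  obtain ⟨ρ, L, hb⟩ := StrangBoundary.exists_trajectoryBounds hT hu_smooth hf_smooth
  have hfu : ContinuousOn (fun s => f (u s)) (Icc 0 T) := fun t ht =>
    (hf_smooth t ht).continuousAt.comp_continuousWithinAt (hu_smooth.continuousOn t ht)
  refine ⟨?_, fun hf₀ hf₁ => ?_, fun hf₀ hf₁ hf₂ => ?_⟩
  · obtain ⟨C, hC⟩ := StrangBoundary.exists_defect_bound_order_one hS' hA' hu hM1 hM hT hb hfu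
    refine ⟨?_, fun hP => ?_⟩
    · simpa using StrangBoundary.localError_of_defect_bound hM hS' hA' hu hM1 hT hb hC
    · obtain ⟨C', hC'⟩ := StrangBoundary.exists_smoothed_defect_bound_order_one hS' hA' hu hM1 hM
        hT hb hfu hP.comp_max
      simpa using StrangBoundary.globalError_of_smoothed_defect_bound hM hS' hA' hu hM1 hT hb
        one_ne_zero hC hC'
  · obtain ⟨g, hg, hfg⟩ := hf₁
    obtain ⟨K, hK⟩ := isCompact_Icc.exists_bound_of_continuousOn hg
    have hfg' := fun t ht => hf₀.mem_graph (hu.hasImageAndBoundaryValue hT ht) (hfg t ht)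
    obtain ⟨C, hC⟩ := StrangBoundary.exists_defect_bound_order_two hS' hA' hu hM1 hM hT hb hfu
      hfg' hK
    refine ⟨StrangBoundary.localError_of_defect_bound hM hS' hA' hu hM1 hT hb hC, fun hP => ?_⟩
    obtain ⟨C', hC'⟩ := StrangBoundary.exists_smoothed_defect_bound_order_two hS' hA' hu hM1 hM
      hT hb hfu hfg' hK hP.comp_max
    exact StrangBoundary.globalError_of_smoothed_defect_bound hM hS' hA' hu hM1 hT hb
      two_ne_zero hC hC'
  · obtain ⟨C, hC⟩ := StrangBoundary.exists_defect_bound_order_three hS' hA' hu hM1 hM hT hb hfu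
      (hu_smooth.differentiableOn (by simp))
      (fun t ht => (hf_smooth t ht).differentiableAt (by simp)) hf₀ hf₁ hf₂
    exact ⟨StrangBoundary.localError_of_defect_bound hM hS' hA' hu hM1 hT hb hC,
      StrangBoundary.globalError_of_defect_bound hM hS' hA' hu hM1 hT hb two_ne_zero hC⟩
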